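/- Let $q\ge 1$ be an integer. Work with formal power series over $\mathbb{Q}$ in variables $p_1,p_2,\dots$ and $\hbar$. Let $\zeta(z)=e^{z/2}-e^{-z/2}$. For a partition $\lambda$ let $s_\lambda(p)$ be the Schur function written as a polynomial in the power sums $p_1,p_2,\dots$, i.e. $s_\lambda=\det\big(h_{\lambda_i-i+j}\big)_{1\le i,j\le \ell(\lambda)}$ with $\sum_{n\ge 0}h_nt^n=\exp\big(\sum_{k\ge1}p_kt^k/k\big)$ and $h_n=0$ for $n<0$; let $s_\lambda(\delta_q)$ be its value at $p_j=\delta_{j,q}$. For a box $\square$ of the Young diagram of $\lambda$ let $\mathrm{cr}^\lambda_\square$ be its content, the column index minus the row index. The partition function of the monotone $q$-orbifold Hurwitz numbers is $$Z=\sum_\lambda s_\lambda(\delta_q)\Big(\prod_{\square\in\lambda}(1-\hbar\,\mathrm{cr}^\lambda_\square)^{-1}\Big)s_\lambda(p),$$ where the sum runs over all partitions, including the empty one. Define operators $Q_r$, $r\ge1$, on power series in the $p$'s by $$\sum_{r\ge1}Q_rz^r=\frac1{\zeta(z)}\sum_{s\ge1}\Bigg(\sum_{\substack{n\ge1,\;k_1,\dots,k_n\ge1\\k_1+\dots+k_n=s}}\frac1{n!}\prod_{i=1}^n\frac{\zeta(k_iz)\,p_{k_i}}{k_i}\Bigg)\Bigg(\sum_{\substack{m\ge1,\;\ell_1,\dots,\ell_m\ge1\\\ell_1+\dots+\ell_m=s}}\frac1{m!}\prod_{j=1}^m\zeta(\ell_jz)\frac{\partial}{\partial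 p_{\ell_j}}\Bigg),$$ define $c_\alpha$ as the coefficient of $z^{2\alpha}$ in $z/\zeta(z)$, and put $$J=\sum_{r\ge2}\hbar^{r-2}(r-1)!\,Q_r+\sum_{\alpha\ge1}c_\alpha\sum_{r\ge1}\hbar^{r-2+2\alpha}(r-1+2\alpha)!\,Q_r .$$ Then: 1. The odd coefficients of $z/\zeta(z)$ vanish, so that $z/\zeta(z)=\sum_{\alpha\ge0}c_\alpha z^{2\alpha}$, and $c_\alpha=\dfrac{(2^{1-2\alpha}-1)B_{2\alpha}}{(2\alpha)!}$ for all $\alpha\ge0$, where $B_n$ are the Bernoulli numbers. 2. $J=\dfrac{\partial/\partial\hbar}{\zeta(\hbar^2\,\partial/\partial\hbar)}\displaystyle\sum_{r\ge1}\hbar^r(r-1)!\,Q_r-\frac1\hbar Q_1$; that is, with $\dfrac{z}{\zeta(z)}=\sum_k\varphi_kz^k$, one has $\hbar^2J=\sum_{k\ge0}\varphi_k\big(\hbar^2\tfrac{\partial}{\partial\hbar}\big)^k\Big(\sum_{r\ge1}\hbar^r(r-1)!\,Q_r\Big)-\hbar Q_1$. 3. $\dfrac{\partial Z}{\partial\hbar}=JZ$.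 -/

import Mathlib

open scoped BigOperators PowerSeries

namespace MonotoneHurwitz

noncomputable section

/-- The formal power series `ζ(z) = e^{z/2} - e^{-z/2}`. -/
def zeta : ℚ⟦X⟧ :=
  PowerSeries.rescale (1 / 2 : ℚ) (PowerSeries.exp ℚ) -
    PowerSeries.rescale (-1 / 2 : ℚ) (PowerSeries.exp ℚ)

/-- The formal power series `z / ζ(z)`, the inverse of `ζ(z) / z`. -/
def zDivZeta : ℚ⟦X⟧ :=
  (PowerSeries.mk fun n => PowerSeries.coeff (n + 1) zeta)⁻¹

theorem zDivZeta_mul_zeta : zDivZeta * zeta = PowerSeries.X := by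
  have h0 : PowerSeries.constantCoeff zeta = 0 := by
    simp only [zeta, ← PowerSeries.coeff_zero_eq_constantCoeff_apply, map_sub,
      PowerSeries.coeff_rescale, pow_zero, sub_self]
  have h1 : zeta = PowerSeries.X * PowerSeries.mk fun n => PowerSeries.coeff (n + 1) zeta := by
    conv_lhs => rw [PowerSeries.eq_X_mul_shift_add_const zeta, h0]
    simp
  have h2 : PowerSeries.constantCoeff
      (PowerSeries.mk fun n => PowerSeries.coeff (n + 1) zeta) ≠ 0 := by
    rw [← PowerSeries.coeff_zero_eq_constantCoeff_apply, PowerSeries.coeff_mk]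
    simp [zeta, PowerSeries.coeff_rescale, PowerSeries.coeff_exp]
    norm_num
  conv_lhs => rw [h1]
  rw [mul_left_comm, zDivZeta, PowerSeries.inv_mul_cancel _ h2, mul_one]

/-- The coefficients `c_α` of the expansion `z / ζ(z) = ∑ α, c_α z^{2α}`. -/
def c (α : ℕ) : ℚ := PowerSeries.coeff (2 * α) zDivZeta

/-- Formal power series in the variables `p₁, p₂, p₃, …`. -/
abbrev PSeries : Type := MvPowerSeries ℕ+ ℚ

/-- The weight of a monomial in the `p`'s, where `p_k` has weight `k`. -/
def wt (m : ℕ+ →₀ ℕ) : ℕ := Finsupp.weight (fun k : ℕ+ => (k : ℕ)) m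

/-- The `i`-th part of a composition, as a positive integer. -/
def part {n : ℕ} (k : Composition n) (i : Fin k.length) : ℕ+ :=
  ⟨k.blocksFun i, k.one_le_blocksFun i⟩

/-- The complete homogeneous symmetric function `h_n` as a polynomial in the power sums, i.e. the
coefficient of `t^n` in `exp (∑ k ≥ 1, p_k t^k / k)`. A `Composition n` is an ordered tuple of
positive integers with sum `n`. -/
def complete (n : ℕ) : MvPolynomial ℕ+ ℚ :=
  ∑ k : Composition n, MvPolynomial.C (1 / (k.length.factorial : ℚ)) *
    ∏ i, MvPolynomial.C (1 / ((part k i : ℕ) : ℚ)) * MvPolynomial.X (part k i)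

/-- The Schur function `s_lam` as a polynomial in the power sums: the Jacobi-Trudi determinant
`det (h_{lam_i - i + j})`, where `h_n = 0` for `n < 0`. -/
def schur (lam : YoungDiagram) : MvPolynomial ℕ+ ℚ :=
  (Matrix.of fun i j : Fin (lam.colLen 0) =>
    if (i : ℕ) ≤ lam.rowLen i + j then complete (lam.rowLen i + j - i) else 0).det

/-- The value `s_lam(δ_q)` of the Schur function at the point `p_j = δ_{j,q}`. -/
def schurDelta (q : ℕ+) (lam : YoungDiagram) : ℚ :=
  MvPolynomial.eval (fun j => if j = q then 1 else 0) (schur lam)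

/-- The content of a box: column index minus row index. Mathlib's cells are pairs `(row, column)`.
-/
def content (b : ℕ × ℕ) : ℤ := (b.2 : ℤ) - (b.1 : ℤ)

/-- `∏_{□ ∈ lam} (1 - ħ cr_□)⁻¹` as a formal power series in `ħ`. -/
def contentProd (lam : YoungDiagram) : ℚ⟦X⟧ :=
  ∏ b ∈ lam.cells, (1 - PowerSeries.C ((content b : ℤ) : ℚ) * PowerSeries.X)⁻¹

/-- The partition function
`Z = ∑_lam s_lam(δ_q) (∏_{□ ∈ lam} (1 - ħ cr_□)⁻¹) s_lam(p)`, as a power series in `ħ` whose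
coefficients are power series in the `p`'s. The sum over all Young diagrams is taken coefficient by
coefficient; each coefficient is a finite sum by `partitionFunction_support_finite`. -/
def partitionFunction (q : ℕ+) : PSeries⟦X⟧ :=
  PowerSeries.mk fun n => (fun m : ℕ+ →₀ ℕ => ∑ᶠ lam : YoungDiagram,
    schurDelta q lam * PowerSeries.coeff n (contentProd lam) *
      MvPolynomial.coeff m (schur lam) : PSeries)

/-- The multiplication operator `∏ i, p_{k_i}`. -/
def mulP {s : ℕ} (k : Composition s) : Module.End ℚ PSeries :=
  LinearMap.mulLeft ℚ (∏ i, MvPowerSeries.X (part k i))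

/-- The differential operator `∏ j, ∂ / ∂ p_{l_j}`. -/
def diffP {s : ℕ} (l : Composition s) : Module.End ℚ PSeries :=
  (List.ofFn fun j => ((MvPowerSeries.pderiv ℚ (part l j)).toLinearMap : Module.End ℚ PSeries)).prod

/-- The coefficient of `z^r` in
`ζ(z)⁻¹ · (1 / n!) ∏_{i ≤ n} (ζ(k_i z) / k_i) · (1 / m!) ∏_{j ≤ m} ζ(l_j z)`;
the factor `ζ(z)⁻¹` is written as `z⁻¹ · (z / ζ(z))`. -/
def qCoeff (r : ℕ) {s : ℕ} (k l : Composition s) : ℚ :=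
  PowerSeries.coeff (r + 1)
    (zDivZeta *
      (PowerSeries.C (1 / (k.length.factorial : ℚ)) *
        ∏ i, PowerSeries.C (1 / ((part k i : ℕ) : ℚ)) *
          PowerSeries.rescale ((part k i : ℕ) : ℚ) zeta) *
      (PowerSeries.C (1 / (l.length.factorial : ℚ)) *
        ∏ j, PowerSeries.rescale ((part l j : ℕ) : ℚ) zeta))

/-- The part of `Q_r` with `k_1 + ⋯ + k_n = l_1 + ⋯ + l_m = s`. -/
def qTerm (r s : ℕ) : Module.End ℚ PSeries :=
  ∑ k : Composition s, ∑ l : Composition s, qCoeff r k l • (mulP k * diffP l)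

/-- The operator `Q_r = ∑_{s ≥ 1} qTerm r s`. Only the terms with `s ≤ wt m` contribute to the
coefficient of the monomial `m` (see `coeff_qTerm_eq_zero` and `coeff_Q_eq_finsum`). -/
def Q (r : ℕ) : Module.End ℚ PSeries where
  toFun f := fun m => ∑ s ∈ Finset.Icc 1 (wt m), MvPowerSeries.coeff m (qTerm r s f)
  map_add' f g := by
    ext m
    change ∑ s ∈ Finset.Icc 1 (wt m), MvPowerSeries.coeff m (qTerm r s (f + g)) =
      ∑ s ∈ Finset.Icc 1 (wt m), MvPowerSeries.coeff m (qTerm r s f) +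
        ∑ s ∈ Finset.Icc 1 (wt m), MvPowerSeries.coeff m (qTerm r s g)
    simp only [map_add, Finset.sum_add_distrib]
  map_smul' a f := by
    ext m
    change ∑ s ∈ Finset.Icc 1 (wt m), MvPowerSeries.coeff m (qTerm r s (a • f)) =
      a * ∑ s ∈ Finset.Icc 1 (wt m), MvPowerSeries.coeff m (qTerm r s f)
    simp only [map_smul, smul_eq_mul, Finset.mul_sum]

theorem coeff_qTerm_eq_zero (r s : ℕ) (f : PSeries) (m : ℕ+ →₀ ℕ) (h : wt m < s) :
    MvPowerSeries.coeff m (qTerm r s f) = 0 := by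
  classical
  have key : ∀ (k : Composition s) (g : PSeries), MvPowerSeries.coeff m (mulP k g) = 0 := by
    intro k g
    have h1 : (∏ i, MvPowerSeries.X (part k i) : PSeries) =
        MvPowerSeries.monomial (∑ i, Finsupp.single (part k i) 1) 1 := by
      have h2 := MvPowerSeries.prod_monomial (R := ℚ)
        (fun i => Finsupp.single (part k i) 1) (fun _ => 1) Finset.univ
      rw [Finset.prod_const_one] at h2
      exact h2
    rw [mulP, LinearMap.mulLeft_apply, h1, MvPowerSeries.coeff_monomial_mul, if_neg]
    intro hle
    have h2 : wt (∑ i, Finsupp.single (part k i) 1) = s := by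
      rw [wt, map_sum]
      simp only [Finsupp.weight_single, one_smul]
      exact k.sum_blocksFun
    have h3 : wt (∑ i, Finsupp.single (part k i) 1) ≤ wt m := by
      obtain ⟨d, hd⟩ := exists_add_of_le hle
      rw [hd, wt, wt, map_add]
      exact Nat.le_add_right _ _
    omega
  simp only [qTerm, LinearMap.sum_apply, LinearMap.smul_apply, map_sum, map_smul,
    Module.End.mul_apply, key, smul_zero, Finset.sum_const_zero]

theorem coeff_Q_eq_finsum (r : ℕ) (f : PSeries) (m : ℕ+ →₀ ℕ) :
    MvPowerSeries.coeff m (Q r f) =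
      ∑ᶠ s ∈ Set.Ici 1, MvPowerSeries.coeff m (qTerm r s f) := by
  have h : MvPowerSeries.coeff m (Q r f) =
      ∑ s ∈ Finset.Icc 1 (wt m), MvPowerSeries.coeff m (qTerm r s f) := rfl
  rw [h]
  symm
  apply finsum_mem_eq_sum_of_inter_support_eq
  ext s
  simp only [Set.mem_inter_iff, Set.mem_Ici, Function.mem_support, Finset.coe_Icc, Set.mem_Icc]
  constructor
  · rintro ⟨h1, h2⟩
    exact ⟨⟨h1, not_lt.1 fun h3 => h2 (coeff_qTerm_eq_zero r s f m h3)⟩, h2⟩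
  · rintro ⟨⟨h1, -⟩, h2⟩
    exact ⟨h1, h2⟩

/-- The series
`J = ∑_{r ≥ 2} ħ^{r-2} (r-1)! Q_r + ∑_{α ≥ 1} c_α ∑_{r ≥ 1} ħ^{r-2+2α} (r-1+2α)! Q_r`
in `ħ` whose coefficients are operators. -/
def J : (Module.End ℚ PSeries)⟦X⟧ :=
  PowerSeries.mk fun n =>
    ((n + 1).factorial : ℚ) • Q (n + 2) +
      ∑ x ∈ Finset.Icc 1 (n + 2) ×ˢ Finset.Icc 1 (n + 2) with x.2 + 2 * x.1 = n + 2,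
        (c x.1 * ((x.2 - 1 + 2 * x.1).factorial : ℚ)) • Q x.2

/-- The action of a power series in `ħ` with operator coefficients on a power series in `ħ`. -/
def act (A : (Module.End ℚ PSeries)⟦X⟧) (F : PSeries⟦X⟧) : PSeries⟦X⟧ :=
  PowerSeries.mk fun n => ∑ x ∈ Finset.HasAntidiagonal.antidiagonal n,
    (PowerSeries.coeff x.1 A) (PowerSeries.coeff x.2 F)

/-- The operation `ħ² ∂/∂ħ` on power series in `ħ` with operator coefficients. -/
def hbarSqDeriv (A : (Module.End ℚ PSeries)⟦X⟧) : (Module.End ℚ PSeries)⟦X⟧ :=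
  PowerSeries.X ^ 2 * PowerSeries.mk fun n => ((n + 1 : ℕ) : ℚ) • PowerSeries.coeff (n + 1) A

/-- `φ(ħ² ∂/∂ħ) A = ∑ k, φ_k (ħ² ∂/∂ħ)^k A` for `φ = ∑ k, φ_k z^k`. Only the terms with `k ≤ n`
contribute to the coefficient of `ħ^n` (see `coeff_iterate_hbarSqDeriv`). -/
def seriesInHbarSqDeriv (φ : ℚ⟦X⟧) (A : (Module.End ℚ PSeries)⟦X⟧) :
    (Module.End ℚ PSeries)⟦X⟧ :=
  PowerSeries.mk fun n => ∑ k ∈ Finset.range (n + 1),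
    PowerSeries.coeff k φ • PowerSeries.coeff n (hbarSqDeriv^[k] A)

theorem coeff_iterate_hbarSqDeriv (A : (Module.End ℚ PSeries)⟦X⟧) (k n : ℕ) (h : n < k) :
    PowerSeries.coeff n (hbarSqDeriv^[k] A) = 0 := by
  induction k generalizing n with
  | zero => omega
  | succ k ih =>
    rw [Function.iterate_succ_apply', hbarSqDeriv]
    rcases n with _ | _ | n
    · simp [PowerSeries.coeff_X_pow_mul']
    · simp [PowerSeries.coeff_X_pow_mul']
    · rw [show n + 1 + 1 = n + 2 from rfl, PowerSeries.coeff_X_pow_mul, PowerSeries.coeff_mk, ih _ (by omega), smul_zero]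

theorem complete_isWeightedHomogeneous (n : ℕ) :
    (complete n).IsWeightedHomogeneous (fun k : ℕ+ => (k : ℕ)) n := by
  unfold complete
  apply MvPolynomial.IsWeightedHomogeneous.sum
  intro k _
  apply MvPolynomial.IsWeightedHomogeneous.C_mul
  have h := MvPolynomial.IsWeightedHomogeneous.prod (w := fun k : ℕ+ => (k : ℕ))
    (Finset.univ : Finset (Fin k.length))
    (fun i => MvPolynomial.C (1 / ((part k i : ℕ) : ℚ)) * MvPolynomial.X (part k i))
    (fun i => (part k i : ℕ))
    (fun i _ => (MvPolynomial.isWeightedHomogeneous_X ℚ _ (part k i)).C_mul _)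
  rwa [show ∑ i, (part k i : ℕ) = n from k.sum_blocksFun] at h

theorem sum_rowLen_eq_card (lam : YoungDiagram) :
    ∑ i : Fin (lam.colLen 0), lam.rowLen i = lam.card := by
  rw [Fin.sum_univ_eq_sum_range (fun i => lam.rowLen i), YoungDiagram.card,
    Finset.card_eq_sum_card_fiberwise (f := Prod.fst) (t := Finset.range (lam.colLen 0))]
  · refine Finset.sum_congr rfl fun i _ => ?_
    rw [YoungDiagram.rowLen_eq_card]
    rfl
  · rintro ⟨i, j⟩ h
    rw [Finset.mem_coe, YoungDiagram.mem_cells] at h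
    rw [Finset.mem_coe, Finset.mem_range, ← YoungDiagram.mem_iff_lt_colLen]
    exact lam.up_left_mem le_rfl (Nat.zero_le j) h

/-- The Schur function of a Young diagram with `d` boxes is homogeneous of weight `d`. -/
theorem schur_isWeightedHomogeneous (lam : YoungDiagram) :
    (schur lam).IsWeightedHomogeneous (fun k : ℕ+ => (k : ℕ)) lam.card := by
  unfold schur
  rw [Matrix.det_apply]
  apply MvPolynomial.IsWeightedHomogeneous.sum
  intro σ _
  rw [Units.smul_def, zsmul_eq_mul]
  rw [← map_intCast (MvPolynomial.C : ℚ →+* MvPolynomial ℕ+ ℚ)]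
  apply MvPolynomial.IsWeightedHomogeneous.C_mul
  by_cases hσ : ∀ i : Fin (lam.colLen 0), (σ i : ℕ) ≤ lam.rowLen (σ i) + i
  · have h := MvPolynomial.IsWeightedHomogeneous.prod (w := fun k : ℕ+ => (k : ℕ))
      (Finset.univ : Finset (Fin (lam.colLen 0)))
      (fun i => complete (lam.rowLen (σ i) + i - σ i))
      (fun i => lam.rowLen (σ i) + i - σ i)
      (fun i _ => complete_isWeightedHomogeneous _)
    have hs : ∑ i : Fin (lam.colLen 0), (lam.rowLen (σ i) + i - σ i) = lam.card := by
      rw [← sum_rowLen_eq_card]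
      have h1 : ∑ i : Fin (lam.colLen 0), (lam.rowLen (σ i) + i - σ i) +
          ∑ i : Fin (lam.colLen 0), (σ i : ℕ) =
          ∑ i : Fin (lam.colLen 0), lam.rowLen (σ i) + ∑ i : Fin (lam.colLen 0), (i : ℕ) := by
        rw [← Finset.sum_add_distrib, ← Finset.sum_add_distrib]
        exact Finset.sum_congr rfl fun i _ => Nat.sub_add_cancel (hσ i)
      rw [Equiv.sum_comp σ (fun i : Fin (lam.colLen 0) => (i : ℕ)),
        Equiv.sum_comp σ (fun i : Fin (lam.colLen 0) => lam.rowLen i)] at h1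
      omega
    rw [hs] at h
    convert h using 1
    refine Finset.prod_congr rfl fun i _ => ?_
    simp [hσ i]
  · push Not at hσ
    obtain ⟨i, hi⟩ := hσ
    rw [Finset.prod_eq_zero (Finset.mem_univ i)]
    · exact MvPolynomial.isWeightedHomogeneous_zero _ _ _
    · simp [hi]

theorem finite_card_eq (d : ℕ) : {lam : YoungDiagram | lam.card = d}.Finite := by
  apply Set.Finite.of_finite_image (f := YoungDiagram.cells)
  · refine Set.Finite.subset
      ((Finset.range d ×ˢ Finset.range d).powerset : Set (Finset (ℕ × ℕ))).toFinite ?_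
    rintro _ ⟨lam, hlam, rfl⟩
    rw [Finset.mem_coe, Finset.mem_powerset]
    rintro ⟨i, j⟩ hij
    rw [YoungDiagram.mem_cells] at hij
    have hlam' : lam.cells.card = d := hlam
    rw [Finset.mem_product, Finset.mem_range, Finset.mem_range]
    constructor
    · have h := Finset.card_le_card (s := Finset.range (i + 1) ×ˢ {0}) (t := lam.cells) (by
        rintro ⟨a, b⟩ hab
        rw [Finset.mem_product, Finset.mem_range, Finset.mem_singleton] at hab
        rw [YoungDiagram.mem_cells]
        exact lam.up_left_mem (by have := hab.1; simp only at this; omega)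
          (by have := hab.2; simp only at this; omega) hij)
      rw [Finset.card_product, Finset.card_range, Finset.card_singleton] at h
      simp only
      omega
    · have h := Finset.card_le_card (s := {0} ×ˢ Finset.range (j + 1)) (t := lam.cells) (by
        rintro ⟨a, b⟩ hab
        rw [Finset.mem_product, Finset.mem_range, Finset.mem_singleton] at hab
        rw [YoungDiagram.mem_cells]
        exact lam.up_left_mem (by have := hab.1; simp only at this; omega)
          (by have := hab.2; simp only at this; omega) hij)
      rw [Finset.card_product, Finset.card_range, Finset.card_singleton] at h
      simp only
      omega
  · intro a _ b _ hab
    exact YoungDiagram.ext hab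

theorem partitionFunction_support_finite (q : ℕ+) (n : ℕ) (m : ℕ+ →₀ ℕ) :
    (Function.support fun lam : YoungDiagram =>
      schurDelta q lam * PowerSeries.coeff n (contentProd lam) *
        MvPolynomial.coeff m (schur lam)).Finite := by
  refine (finite_card_eq (wt m)).subset fun lam h => ?_
  by_contra hne
  refine h ?_
  simp only
  rw [(schur_isWeightedHomogeneous lam).coeff_eq_zero m (fun h' => hne h'.symm), mul_zero]

end

end MonotoneHurwitz

/-! Schur functions diagonalise everything. Put `u = e^{z/2}`, `v = e^{-z/2}`, so `u v = 1`. The two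
exponential sums over compositions defining `Q_r` assemble into a vertex operator `V` (`vertexOp`),
the coefficient of `x^0` in `exp(∑ (u^k - v^k) p_k x^k / k) exp(∑ (u^k - v^k) x^{-k} ∂_k)`; on
polynomials, `∑ Q_r z^r = (V - 1) / ζ(z)`, the `-1` removing the term `s = 0`.

By Jacobi-Trudi, a Schur function is a product of Bernstein operators `B_n` applied to `1`
(`jacobiTrudi_succ`). Moving `V` past `B_n` compares `(1 - v t/x) / (1 - u t/x)`, expanded in `t/x`,
with `(1 - u x/t) / (1 - v x/t)`, expanded in `x/t`. As `u v = 1`, the first rational function is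
`v^2` times the second, so the expansions differ by a delta function at `x = u t`, where the
normally ordered product is again a Bernstein operator. Hence `V B_n = v^2 B_n V + (u - v) v u^{2n}
B_n` (`vertexOp_bernsteinOp`), and induction on the rows gives `V s_λ = (1 + ζ^2 ∑_□ e^{cr z}) s_λ`
(`vertexOp_jacobiTrudi`), which is `Q_schur`.

The coefficient of `ħ^n` in `J` is `(n+1)!` times the coefficient of `z^{n+2}` in `(z/ζ) ∑ Q_r z^r`,
with `r ≥ 1`. The factor `z/ζ` cancels the `ζ` in the eigenvalue, leaving `∑_□ cr^{n+1}`
(`coeff_J_schur`), the coefficient of `ħ^n` in the logarithmic derivative of `∏ (1 - ħ cr)⁻¹`. So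
each summand of `Z` satisfies the equation. As every operator preserves weight, each coefficient of
`Z` involves finitely many summands (`EqInWeight`). -/

namespace MonotoneHurwitz

noncomputable section

/-! ### Exponentials as sums over compositions, in a noncommutative ring -/

section ExpCoeff

variable {A : Type*} [Ring A]

/-- The composition of `s` with first block `j` and remaining blocks `c`. -/
def consComposition {s j : ℕ} (hj : 1 ≤ j) (hs : j ≤ s) (c : Composition (s - j)) :
    Composition s where
  blocks := j :: c.blocks
  blocks_pos := by
    intro i hi
    rcases List.mem_cons.1 hi with rfl | hi
    · exact hj
    · exact c.blocks_pos hi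
  blocks_sum := by rw [List.sum_cons, c.blocks_sum]; omega

theorem sum_composition_length_succ {M : Type*} [AddCommMonoid M] (F : List ℕ → M) (n s : ℕ) :
    ∑ k : Composition s with k.length = n + 1, F k.blocks =
      ∑ j ∈ Finset.Icc 1 s, ∑ c : Composition (s - j) with c.length = n, F (j :: c.blocks) := by
  symm
  rw [Finset.sum_sigma']
  refine Finset.sum_bij
    (fun x hx => consComposition (Finset.mem_Icc.1 (Finset.mem_sigma.1 hx).1).1
      (Finset.mem_Icc.1 (Finset.mem_sigma.1 hx).1).2 x.2) ?_ ?_ ?_ ?_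
  · rintro ⟨j, c⟩ hx
    simp only [Finset.mem_sigma, Finset.mem_filter, Finset.mem_univ, true_and] at hx ⊢
    simp only [Composition.length, consComposition, List.length_cons] at hx ⊢
    omega
  · rintro ⟨j, c⟩ hx ⟨j', c'⟩ hx' h
    have h1 := congrArg Composition.blocks h
    simp only [consComposition, List.cons.injEq] at h1
    obtain ⟨rfl, h2⟩ := h1
    rw [Composition.ext h2]
  · intro k hk
    simp only [Finset.mem_filter, Finset.mem_univ, true_and, Composition.length] at hk
    obtain ⟨j, l, hjl⟩ : ∃ j l, k.blocks = j :: l := by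
      cases h : k.blocks with
      | nil => rw [h] at hk; simp at hk
      | cons j l => exact ⟨j, l, rfl⟩
    have hsum := k.blocks_sum
    rw [hjl, List.sum_cons] at hsum
    have hj : 1 ≤ j := k.one_le_blocks (by rw [hjl]; simp)
    refine ⟨⟨j, ⟨l, fun {i} hi => k.blocks_pos (by rw [hjl]; simp [hi]), by omega⟩⟩, ?_, ?_⟩
    · simp only [Finset.mem_sigma, Finset.mem_Icc, Finset.mem_filter, Finset.mem_univ, true_and,
        Composition.length]
      rw [hjl, List.length_cons] at hk
      omega
    · exact Composition.ext hjl.symm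
  · rintro ⟨j, c⟩ hx
    rfl

/-- The power series `∑ k ≥ 1, a_k x^k`. -/
def genSeries (a : ℕ+ → A) : A⟦X⟧ :=
  PowerSeries.mk fun n => if h : 0 < n then a ⟨n, h⟩ else 0

theorem coeff_genSeries_zero (a : ℕ+ → A) : PowerSeries.coeff 0 (genSeries a) = 0 := by
  simp [genSeries]

theorem coeff_genSeries_of_pos (a : ℕ+ → A) {n : ℕ} (h : 0 < n) :
    PowerSeries.coeff n (genSeries a) = a ⟨n, h⟩ := by
  simp [genSeries, h]

theorem coeff_genSeries_pow_blocks (a : ℕ+ → A) (n s : ℕ) :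
    PowerSeries.coeff s (genSeries a ^ n) =
      ∑ k : Composition s with k.length = n,
        (k.blocks.map fun j => PowerSeries.coeff j (genSeries a)).prod := by
  induction n generalizing s with
  | zero =>
    rw [pow_zero, PowerSeries.coeff_one]
    split_ifs with hs
    · subst hs
      rw [Finset.filter_true_of_mem (fun k _ => Nat.le_zero.1 k.length_le), Fintype.sum_eq_single
        (Composition.ones 0) (fun k hk => absurd (Composition.ext
          (List.length_eq_zero_iff.1 (Nat.le_zero.1 k.length_le))) hk)]
      simp [Composition.ones]
    · rw [Finset.sum_eq_zero]
      intro k hk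
      simp only [Finset.mem_filter, Finset.mem_univ, true_and] at hk
      exact absurd (by simpa using k.length_pos_iff.not.1 (by omega)) hs
  | succ n ih =>
    rw [sum_composition_length_succ
      (fun l => (l.map fun j => PowerSeries.coeff j (genSeries a)).prod), pow_succ',
      PowerSeries.coeff_mul, Finset.Nat.sum_antidiagonal_eq_sum_range_succ
        (fun i j => PowerSeries.coeff i (genSeries a) * PowerSeries.coeff j (genSeries a ^ n)),
      Finset.sum_range_succ', coeff_genSeries_zero, zero_mul, add_zero,
      Finset.range_eq_Ico, Finset.sum_Ico_add' (fun i =>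
        PowerSeries.coeff i (genSeries a) * PowerSeries.coeff (s - i) (genSeries a ^ n))]
    refine Finset.sum_congr (by ext; simp [Nat.succ_le_iff]) fun j hj => ?_
    rw [ih, Finset.mul_sum]
    simp

theorem coeff_genSeries_pow (a : ℕ+ → A) (n s : ℕ) :
    PowerSeries.coeff s (genSeries a ^ n) =
      ∑ k : Composition s with k.length = n, (List.ofFn fun i => a (part k i)).prod := by
  rw [coeff_genSeries_pow_blocks]
  refine Finset.sum_congr rfl fun k _ => ?_
  rw [← k.ofFn_blocksFun, List.map_ofFn]
  congr 2
  ext i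
  simp only [Function.comp]
  rw [coeff_genSeries_of_pos a (k.one_le_blocksFun i)]
  rfl

variable [Algebra ℚ A]

/-- The coefficient of `x^s` in `exp (∑ k ≥ 1, a_k x^k)`, as a sum over compositions of `s`. -/
def expCoeff (a : ℕ+ → A) (s : ℕ) : A :=
  ∑ k : Composition s, (1 / (k.length.factorial : ℚ)) • (List.ofFn fun i => a (part k i)).prod

/-- A composition of `s` has at most `s` blocks, so the exponential series may be cut at any `N >
s`. Ordered compositions make this valid for operator coefficients too. -/
theorem expCoeff_eq_sum (a : ℕ+ → A) {s N : ℕ} (h : s < N) :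
    expCoeff a s = ∑ n ∈ Finset.range N,
      (1 / (n.factorial : ℚ)) • PowerSeries.coeff s (genSeries a ^ n) := by
  simp only [coeff_genSeries_pow, Finset.smul_sum]
  rw [expCoeff, ← Finset.sum_fiberwise_of_maps_to (s := Finset.univ) (t := Finset.range N)
    (g := fun k : Composition s => k.length)
    (fun k _ => Finset.mem_range.2 (lt_of_le_of_lt k.length_le h))]
  refine Finset.sum_congr rfl fun n _ => Finset.sum_congr rfl fun k hk => ?_
  rw [show n = k.length from (Finset.mem_filter.1 hk).2.symm]

theorem expCoeff_zero_right (a : ℕ+ → A) : expCoeff a 0 = 1 := by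
  rw [expCoeff_eq_sum a Nat.zero_lt_one]
  simp

end ExpCoeff

/-! ### Exponentials with commuting coefficients -/

section Geom

variable {A : Type*} [CommRing A]

/-- The power series `1 / (1 - α x)`. -/
def geom (α : A) : A⟦X⟧ := PowerSeries.mk fun n => α ^ n

theorem geom_mul (α : A) : geom α * (1 - PowerSeries.C α * PowerSeries.X) = 1 := by
  ext n
  rcases n with _ | n
  · simp [geom]
  · rw [mul_sub, mul_one, ← mul_assoc, map_sub, PowerSeries.coeff_succ_mul_X,
      PowerSeries.coeff_mul_C]
    simp [geom, pow_succ, PowerSeries.coeff_one]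

theorem genSeries_add (a b : ℕ+ → A) : genSeries (a + b) = genSeries a + genSeries b := by
  ext n
  rcases Nat.eq_zero_or_pos n with rfl | h
  · simp only [coeff_genSeries_zero, map_add, add_zero]
  · simp only [coeff_genSeries_of_pos _ h, map_add]
    rfl

end Geom

section Comm

variable {A : Type*} [CommRing A] [Algebra ℚ A]

/-- The power series `exp (∑ k ≥ 1, a_k x^k)`. -/
def expSeries (a : ℕ+ → A) : A⟦X⟧ := PowerSeries.mk (expCoeff a)

theorem coeff_expSeries (a : ℕ+ → A) (n : ℕ) :
    PowerSeries.coeff n (expSeries a) = expCoeff a n := PowerSeries.coeff_mk _ _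

theorem derivative_expSeries (a : ℕ+ → A) :
    PowerSeries.derivative A (expSeries a) =
      PowerSeries.derivative A (genSeries a) * expSeries a := by
  ext n
  set T : A⟦X⟧ := ∑ m ∈ Finset.range (n + 2), (1 / (m.factorial : ℚ)) • genSeries a ^ m with hT
  set U : A⟦X⟧ := ∑ m ∈ Finset.range (n + 1), (1 / (m.factorial : ℚ)) • genSeries a ^ m with hU
  have h1 : PowerSeries.coeff n (PowerSeries.derivative A (expSeries a)) =
      PowerSeries.coeff n (PowerSeries.derivative A T) := by
    rw [PowerSeries.coeff_derivative, PowerSeries.coeff_derivative, coeff_expSeries,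
      expCoeff_eq_sum a (show n + 1 < n + 2 by omega), hT, map_sum]
    rfl
  have h2 : PowerSeries.coeff n (PowerSeries.derivative A (genSeries a) * expSeries a) =
      PowerSeries.coeff n (PowerSeries.derivative A (genSeries a) * U) := by
    rw [PowerSeries.coeff_mul, PowerSeries.coeff_mul]
    refine Finset.sum_congr rfl fun x hx => ?_
    rw [Finset.HasAntidiagonal.mem_antidiagonal] at hx
    rw [coeff_expSeries, expCoeff_eq_sum a (show x.2 < n + 1 by omega), hU, map_sum]
    rfl
  rw [h1, h2]
  congr 1
  rw [hT, Finset.sum_range_succ', map_add, hU, Finset.mul_sum, map_sum]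
  have h0 : PowerSeries.derivative A
      ((1 / ((0 : ℕ).factorial : ℚ)) • genSeries a ^ 0) = 0 := by
    simp
  rw [h0, add_zero]
  refine Finset.sum_congr rfl fun m _ => ?_
  rw [Derivation.map_smul_of_tower, PowerSeries.derivative_pow, Nat.factorial_succ,
    Nat.add_sub_cancel, mul_assoc, ← nsmul_eq_mul, ← Nat.cast_smul_eq_nsmul ℚ, smul_smul,
    mul_comm (genSeries a ^ m), mul_smul_comm]
  congr 1
  have := Nat.factorial_ne_zero m
  push_cast
  field_simp

/-- The equation `F' = a' F` determines the coefficients recursively, because `n + 1` is invertible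
in a `ℚ`-algebra. This yields additivity of `exp` and the formula for `1 / (1 - α x)`. -/
theorem expSeries_unique (a : ℕ+ → A) (F : A⟦X⟧) (h0 : PowerSeries.coeff 0 F = 1)
    (hF : PowerSeries.derivative A F = PowerSeries.derivative A (genSeries a) * F) :
    F = expSeries a := by
  ext n
  induction n using Nat.strong_induction_on with
  | _ n ih =>
    rcases n with _ | n
    · rw [h0, coeff_expSeries, expCoeff_zero_right]
    · have h1 : PowerSeries.coeff n (PowerSeries.derivative A F) =
          PowerSeries.coeff n (PowerSeries.derivative A (expSeries a)) := by
        rw [hF, derivative_expSeries, PowerSeries.coeff_mul, PowerSeries.coeff_mul]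
        refine Finset.sum_congr rfl fun x hx => ?_
        rw [Finset.HasAntidiagonal.mem_antidiagonal] at hx
        rw [ih x.2 (by omega)]
      rw [PowerSeries.coeff_derivative, PowerSeries.coeff_derivative] at h1
      have h2 : IsUnit ((n : A) + 1) := by
        have : ((n : A) + 1) = algebraMap ℚ A ((n : ℚ) + 1) := by simp
        rw [this]
        exact (IsUnit.mk0 _ (by positivity)).map _
      exact h2.mul_right_cancel h1

theorem expSeries_add (a b : ℕ+ → A) : expSeries (a + b) = expSeries a * expSeries b := by
  symm
  apply expSeries_unique
  · simp only [PowerSeries.coeff_mul, Finset.Nat.antidiagonal_zero, Finset.sum_singleton,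
      coeff_expSeries, expCoeff_zero_right, mul_one]
  · rw [Derivation.leibniz, derivative_expSeries, derivative_expSeries, genSeries_add, map_add,
      smul_eq_mul, smul_eq_mul]
    ring

theorem expCoeff_add (a b : ℕ+ → A) (n : ℕ) :
    expCoeff (fun k => a k + b k) n =
      ∑ x ∈ Finset.HasAntidiagonal.antidiagonal n, expCoeff a x.1 * expCoeff b x.2 := by
  have := congrArg (PowerSeries.coeff n) (expSeries_add a b)
  simp only [coeff_expSeries, PowerSeries.coeff_mul] at this
  exact this

theorem map_expCoeff {B : Type*} [CommRing B] [Algebra ℚ B] (f : A →+* B) (a : ℕ+ → A) (n : ℕ) :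
    f (expCoeff a n) = expCoeff (fun k => f (a k)) n := by
  simp only [expCoeff, map_sum, map_rat_smul f, map_list_prod, List.map_ofFn]
  rfl

theorem expCoeff_rescale (r : A) (a : ℕ+ → A) (n : ℕ) :
    expCoeff (fun k => r ^ (k : ℕ) * a k) n = r ^ n * expCoeff a n := by
  simp only [expCoeff, Finset.mul_sum, List.prod_ofFn, Finset.prod_mul_distrib,
    Finset.prod_pow_eq_pow_sum, mul_smul_comm]
  refine Finset.sum_congr rfl fun k _ => ?_
  rw [show ∑ i, (part k i : ℕ) = n from k.sum_blocksFun]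

theorem geom_eq_expSeries (α : A) :
    geom α = expSeries fun k => (1 / ((k : ℕ) : ℚ)) • α ^ (k : ℕ) := by
  apply expSeries_unique
  · simp [geom]
  · have h1 : PowerSeries.derivative A (genSeries fun k : ℕ+ => (1 / ((k : ℕ) : ℚ)) • α ^ (k : ℕ)) =
        PowerSeries.C α * geom α := by
      ext n
      rw [PowerSeries.coeff_derivative, coeff_genSeries_of_pos _ (Nat.succ_pos n),
        PowerSeries.coeff_C_mul, geom, PowerSeries.coeff_mk, PNat.mk_coe, smul_mul_assoc,
        ← Nat.cast_succ, mul_comm, ← nsmul_eq_mul, ← Nat.cast_smul_eq_nsmul ℚ, smul_smul,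
        one_div_mul_cancel (by positivity), one_smul, pow_succ']
    have h2 := congrArg (PowerSeries.derivative A) (geom_mul α)
    rw [Derivation.leibniz] at h2
    simp only [map_sub, Derivation.leibniz, PowerSeries.derivative_C, PowerSeries.derivative_X,
      PowerSeries.derivative_one, smul_eq_mul, mul_one, mul_zero, add_zero, zero_sub] at h2
    have h3 := geom_mul α
    rw [h1]
    linear_combination (geom α) * h2 - (PowerSeries.derivative A (geom α) ) * h3

/-- The exponential is `(1 - β x) / (1 - α x)`, a quotient of two geometric series. -/
theorem expCoeff_pow_sub_pow (α β : A) (n : ℕ) :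
    expCoeff (fun k => (1 / ((k : ℕ) : ℚ)) • (α ^ (k : ℕ) - β ^ (k : ℕ))) n =
      if n = 0 then 1 else α ^ (n - 1) * (α - β) := by
  set E := expSeries fun k : ℕ+ => (1 / ((k : ℕ) : ℚ)) • (α ^ (k : ℕ) - β ^ (k : ℕ)) with hE
  have h1 : geom α = E * geom β := by
    rw [geom_eq_expSeries, geom_eq_expSeries, hE, ← expSeries_add]
    congr 1
    ext k
    simp [smul_sub]
  have h2 : E = geom α * (1 - PowerSeries.C β * PowerSeries.X) := by
    rw [h1, mul_assoc, geom_mul, mul_one]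
  rw [← coeff_expSeries, ← hE, h2]
  rcases n with _ | n
  · simp [geom]
  · rw [mul_sub, mul_one, ← mul_assoc, map_sub, PowerSeries.coeff_succ_mul_X,
      PowerSeries.coeff_mul_C]
    simp [geom, pow_succ, mul_sub]

end Comm

/-! ### Translations of the power sums and Taylor's formula -/

section Shift

theorem pow_succ_mul_of_commutator {A : Type*} [Ring A] {d p e : A} (h : d * p = p * d + e)
    (hc : Commute d e) (n : ℕ) :
    d ^ (n + 1) * p = p * d ^ (n + 1) + (n + 1 : ℕ) • (e * d ^ n) := by
  induction n with
  | zero => simpa using h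
  | succ n ih =>
    have h1 : d * (e * d ^ n) = e * d ^ (n + 1) := by
      rw [← mul_assoc, hc.eq, mul_assoc, pow_succ']
    rw [pow_succ' d (n + 1), mul_assoc, ih, mul_add, ← mul_assoc d p, h, add_mul, mul_smul_comm, h1,
      mul_assoc p, ← pow_succ', add_assoc]
    congr 1
    rw [succ_nsmul' _ (n + 1)]

theorem list_prod_apply_eq_zero {R M : Type*} [CommRing R] [AddCommGroup M] [Module R M]
    (l : List (Module.End R M)) (hl : l ≠ []) (x : M) (h : ∀ g ∈ l, g x = 0) : l.prod x = 0 := by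
  induction l with
  | nil => exact absurd rfl hl
  | cons g t ih =>
    rw [List.prod_cons, Module.End.mul_apply]
    rcases eq_or_ne t [] with rfl | ht
    · simpa using h g (by simp)
    · rw [ih ht fun g' hg' => h g' (by simp [hg']), map_zero]

variable {R : Type*} [CommRing R]

/-- The differential operators `c_k ∂ / ∂ p_k`. -/
def derivOp (c : ℕ+ → R) (k : ℕ+) : Module.End R (MvPolynomial ℕ+ R) :=
  c k • (MvPolynomial.pderiv k).toLinearMap

theorem derivOp_apply (c : ℕ+ → R) (k : ℕ+) (f : MvPolynomial ℕ+ R) :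
    derivOp c k f = c k • MvPolynomial.pderiv k f := rfl

/-- The substitution `p_k ↦ p_k + c_k y^k`. -/
def shift (c : ℕ+ → R) : MvPolynomial ℕ+ R →ₐ[R] Polynomial (MvPolynomial ℕ+ R) :=
  MvPolynomial.aeval fun k => Polynomial.C (MvPolynomial.X k) +
    Polynomial.C (MvPolynomial.C (c k)) * Polynomial.X ^ (k : ℕ)

theorem shift_C (c : ℕ+ → R) (a : R) :
    shift c (MvPolynomial.C a) = Polynomial.C (MvPolynomial.C a) := by
  rw [MvPolynomial.algHom_C, Polynomial.algebraMap_apply]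
  rfl

theorem shift_X (c : ℕ+ → R) (k : ℕ+) :
    shift c (MvPolynomial.X k) = Polynomial.C (MvPolynomial.X k) +
      Polynomial.C (MvPolynomial.C (c k)) * Polynomial.X ^ (k : ℕ) :=
  MvPolynomial.aeval_X _ _

theorem map_shift_C (c d : ℕ+ → R) (a : R) :
    (shift c (MvPolynomial.C a)).map (shift d).toRingHom =
      Polynomial.C (Polynomial.C (MvPolynomial.C a)) := by
  rw [shift_C, Polynomial.map_C]
  exact congrArg _ (shift_C d a)

theorem map_shift_X (c d : ℕ+ → R) (k : ℕ+) :
    (shift c (MvPolynomial.X k)).map (shift d).toRingHom =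
      Polynomial.C (Polynomial.C (MvPolynomial.X k)) +
      Polynomial.C (Polynomial.C (MvPolynomial.C (d k))) * Polynomial.C Polynomial.X ^ (k : ℕ) +
      Polynomial.C (Polynomial.C (MvPolynomial.C (c k))) * Polynomial.X ^ (k : ℕ) := by
  have h1 : (shift d).toRingHom (MvPolynomial.X k) = _ := shift_X d k
  have h2 : (shift d).toRingHom (MvPolynomial.C (c k)) = _ := shift_C d (c k)
  rw [shift_X, Polynomial.map_add, Polynomial.map_mul, Polynomial.map_pow, Polynomial.map_C,
    Polynomial.map_C, Polynomial.map_X, h1, h2, Polynomial.C_add, Polynomial.C_mul,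
    Polynomial.C_pow]

/-- Translations commute; only the roles of the two auxiliary variables are exchanged. -/
theorem swap_map_shift (c d : ℕ+ → R) (f : MvPolynomial ℕ+ R) :
    Polynomial.Bivariate.swap ((shift c f).map (shift d).toRingHom) =
      (shift d f).map (shift c).toRingHom := by
  induction f using MvPolynomial.induction_on with
  | C a => rw [map_shift_C, map_shift_C, Polynomial.Bivariate.swap_C_C]
  | add f g hf hg => simp only [map_add, Polynomial.map_add, hf, hg]
  | mul_X f k hf =>
    rw [map_mul, map_mul, Polynomial.map_mul, Polynomial.map_mul, map_mul, hf, map_shift_X,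
      map_shift_X]
    simp only [map_add, map_mul, map_pow, Polynomial.Bivariate.swap_C_C,
      Polynomial.Bivariate.swap_X, Polynomial.Bivariate.swap_Y]
    ring

/-- The Heisenberg relation `[D, p_k] = c_k x^k` for `D = ∑ c_j x^j ∂_j`. -/
theorem genSeries_derivOp_mul (c : ℕ+ → R) (k : ℕ+) :
    genSeries (derivOp c) * PowerSeries.C (LinearMap.mulLeft R (MvPolynomial.X k)) =
      PowerSeries.C (LinearMap.mulLeft R (MvPolynomial.X k)) * genSeries (derivOp c) +
        c k • PowerSeries.X ^ (k : ℕ) := by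
  classical
  ext1 n
  rw [map_add, PowerSeries.coeff_mul_C, PowerSeries.coeff_C_mul, PowerSeries.coeff_smul,
    PowerSeries.coeff_X_pow]
  rcases Nat.eq_zero_or_pos n with rfl | h
  · rw [coeff_genSeries_zero, if_neg k.pos.ne, zero_mul, mul_zero, smul_zero, add_zero]
  · lift n to ℕ+ using h
    rw [coeff_genSeries_of_pos _ n.pos, show (⟨(n : ℕ), n.pos⟩ : ℕ+) = n from rfl]
    apply LinearMap.ext
    intro f
    simp only [Module.End.mul_apply, LinearMap.mulLeft_apply, LinearMap.add_apply, derivOp_apply,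
      Derivation.leibniz, smul_eq_mul, MvPolynomial.pderiv_X, smul_add]
    rw [mul_smul_comm]
    congr 1
    by_cases hk : n = k
    · subst hk
      simp [MvPolynomial.smul_eq_C_mul, mul_comm]
    · rw [if_neg (fun h => hk (PNat.coe_inj.1 h)), Pi.single_eq_of_ne (Ne.symm hk)]
      simp

variable [Algebra ℚ R]

/-- Since `[D, p_k]` commutes with `D`, `exp(D) p_k = (p_k + c_k x^k) exp(D)`. The substitution
`shift` obeys the same recursion, which is how Taylor's formula `coeff_shift` follows. -/
theorem expCoeff_derivOp_X_mul (c : ℕ+ → R) (k : ℕ+) (s : ℕ) (f : MvPolynomial ℕ+ R) :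
    expCoeff (derivOp c) s (MvPolynomial.X k * f) =
      MvPolynomial.X k * expCoeff (derivOp c) s f +
        if (k : ℕ) ≤ s then MvPolynomial.C (c k) * expCoeff (derivOp c) (s - k) f else 0 := by
  set P : Module.End R (MvPolynomial ℕ+ R) := LinearMap.mulLeft R (MvPolynomial.X k) with hP
  set e : (Module.End R (MvPolynomial ℕ+ R))⟦X⟧ :=
    c k • PowerSeries.X ^ (k : ℕ) with he
  have hcomm : Commute (genSeries (derivOp c)) e := by
    rw [he]
    exact ((PowerSeries.commute_X_pow _ _)).smul_right _
  have hpow := fun n => pow_succ_mul_of_commutator (genSeries_derivOp_mul c k) hcomm n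
  have hcoe : ∀ n, PowerSeries.coeff s (e * genSeries (derivOp c) ^ n) =
      if (k : ℕ) ≤ s then c k • PowerSeries.coeff (s - k) (genSeries (derivOp c) ^ n) else 0 := by
    intro n
    rw [he, smul_mul_assoc, PowerSeries.coeff_smul, PowerSeries.coeff_X_pow_mul']
    split_ifs <;> simp
  have main : expCoeff (derivOp c) s * P = P * expCoeff (derivOp c) s +
      if (k : ℕ) ≤ s then c k • expCoeff (derivOp c) (s - k) else 0 := by
    rw [expCoeff_eq_sum (derivOp c) (show s < s + 1 + 1 by omega), Finset.sum_range_succ',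
      add_mul, mul_add, Finset.sum_mul, Finset.mul_sum]
    have h0 : ∀ t : Module.End R (MvPolynomial ℕ+ R), PowerSeries.coeff s
        (1 : (Module.End R (MvPolynomial ℕ+ R))⟦X⟧) * t = t * PowerSeries.coeff s 1 := by
      intro t
      rw [PowerSeries.coeff_one]
      split_ifs <;> simp
    have h1 : ∀ n, (1 / ((n + 1).factorial : ℚ)) •
        PowerSeries.coeff s (genSeries (derivOp c) ^ (n + 1)) * P =
        P * (1 / ((n + 1).factorial : ℚ)) • PowerSeries.coeff s (genSeries (derivOp c) ^ (n + 1)) +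
        (1 / (n.factorial : ℚ)) • (if (k : ℕ) ≤ s then
          c k • PowerSeries.coeff (s - k) (genSeries (derivOp c) ^ n) else 0) := by
      intro n
      have := congrArg (PowerSeries.coeff s) (hpow n)
      rw [PowerSeries.coeff_mul_C, map_add, PowerSeries.coeff_C_mul, map_nsmul, hcoe] at this
      rw [smul_mul_assoc, this, smul_add, mul_smul_comm, ← Nat.cast_smul_eq_nsmul ℚ, smul_smul]
      congr 2
      rw [Nat.factorial_succ]
      have := Nat.factorial_ne_zero n
      push_cast
      field_simp
    rw [Finset.sum_congr rfl fun n _ => h1 n, Finset.sum_add_distrib, pow_zero, smul_mul_assoc,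
      mul_smul_comm, h0, add_right_comm]
    congr 1
    split_ifs with hk
    · rw [expCoeff_eq_sum (derivOp c) (show s - k < s + 1 by omega), Finset.smul_sum]
      exact Finset.sum_congr rfl fun n _ => smul_comm _ _ _
    · simp
  have := congrArg (fun T : Module.End R (MvPolynomial ℕ+ R) => T f) main
  simp only [Module.End.mul_apply, LinearMap.add_apply, hP, LinearMap.mulLeft_apply] at this
  rw [this]
  congr 1
  split_ifs
  · rw [LinearMap.smul_apply, MvPolynomial.smul_eq_C_mul]
  · rfl

theorem expCoeff_derivOp_C (c : ℕ+ → R) (s : ℕ) (a : R) :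
    expCoeff (derivOp c) s (MvPolynomial.C a) = if s = 0 then MvPolynomial.C a else 0 := by
  split_ifs with hs
  · subst hs
    rw [expCoeff_zero_right]
    rfl
  · rw [expCoeff, LinearMap.sum_apply]
    refine Finset.sum_eq_zero fun k _ => ?_
    rw [LinearMap.smul_apply, list_prod_apply_eq_zero, smul_zero]
    · rw [Ne, List.ofFn_eq_nil_iff]
      exact (k.length_pos_of_pos (Nat.pos_of_ne_zero hs)).ne'
    · intro g hg
      obtain ⟨i, rfl⟩ := List.mem_ofFn.1 hg
      simp [derivOp_apply]

/-- The Taylor expansion of the substitution `p_k ↦ p_k + c_k y^k`. -/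
theorem coeff_shift (c : ℕ+ → R) (f : MvPolynomial ℕ+ R) (s : ℕ) :
    (shift c f).coeff s = expCoeff (derivOp c) s f := by
  induction f using MvPolynomial.induction_on generalizing s with
  | C a =>
    rw [expCoeff_derivOp_C, shift_C, Polynomial.coeff_C]
  | add f g hf hg => rw [map_add, Polynomial.coeff_add, hf, hg, map_add]
  | mul_X f k hf =>
    rw [mul_comm f, expCoeff_derivOp_X_mul, map_mul, shift_X, add_mul,
      Polynomial.coeff_add, Polynomial.coeff_C_mul, hf, mul_assoc, Polynomial.coeff_C_mul,
      Polynomial.coeff_X_pow_mul']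
    split_ifs
    · rw [hf]
    · rw [mul_zero]

end Shift

/-! ### Extraction of constant terms, in one and two variables -/

section Pairing

variable {S : Type*} [CommRing S]

/-- The `S`-linear map with `X ^ j ↦ g j`. -/
def pairing (g : ℕ → S) : Polynomial S →ₗ[S] S :=
  Polynomial.lsum fun j => LinearMap.toSpanSingleton S S (g j)

theorem pairing_monomial (g : ℕ → S) (j : ℕ) (c : S) :
    pairing g (Polynomial.monomial j c) = c * g j := by
  simp [pairing, Polynomial.sum_monomial_index]

theorem map_pairing {T : Type*} [CommRing T] (φ : S →+* T) (g : ℕ → S) (q : Polynomial S) :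
    φ (pairing g q) = pairing (fun j => φ (g j)) (q.map φ) := by
  induction q using Polynomial.induction_on' with
  | add p q hp hq => rw [map_add, map_add, hp, hq, Polynomial.map_add, map_add]
  | monomial n a => rw [Polynomial.map_monomial, pairing_monomial, pairing_monomial, map_mul]

theorem pairing_eq_sum (g : ℕ → S) (q : Polynomial S) {N : ℕ} (h : q.natDegree < N) :
    pairing g q = ∑ j ∈ Finset.range N, q.coeff j * g j := by
  conv_lhs => rw [Polynomial.as_sum_range' q N h]
  simp only [map_sum, pairing_monomial]

/-- The substitution `y ↦ a v`, `w ↦ b v` on `S[y][w]`. -/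
def evalTwo (a b : S) : Polynomial (Polynomial S) →+* Polynomial S :=
  Polynomial.eval₂RingHom (Polynomial.eval₂RingHom Polynomial.C (Polynomial.C a * Polynomial.X))
    (Polynomial.C b * Polynomial.X)

theorem evalTwo_C_C (a b c : S) :
    evalTwo a b (Polynomial.C (Polynomial.C c)) = Polynomial.C c := by
  simp [evalTwo]

theorem evalTwo_C_X (a b : S) :
    evalTwo a b (Polynomial.C Polynomial.X) = Polynomial.C a * Polynomial.X := by
  simp [evalTwo]

theorem evalTwo_X (a b : S) : evalTwo a b Polynomial.X = Polynomial.C b * Polynomial.X := by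
  simp [evalTwo]

theorem evalTwo_monomial (a b c : S) (j s : ℕ) :
    evalTwo a b (Polynomial.monomial j (Polynomial.monomial s c)) =
      Polynomial.monomial (j + s) (b ^ j * a ^ s * c) := by
  simp only [← Polynomial.C_mul_X_pow_eq_monomial, map_mul, map_pow, evalTwo_C_C, evalTwo_C_X,
    evalTwo_X]
  ring

end Pairing

section Antidiagonal

variable {M : Type*} [AddCommMonoid M]

theorem sum_antidiagonal_eq_first_add (N : ℕ) (F : ℕ → ℕ → M) :
    ∑ x ∈ Finset.HasAntidiagonal.antidiagonal N, F x.1 x.2 =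
      F 0 N + ∑ m ∈ Finset.range N, F (m + 1) (N - (m + 1)) := by
  rw [Finset.Nat.sum_antidiagonal_eq_sum_range_succ F, Finset.sum_range_succ', add_comm,
    Nat.sub_zero]

theorem sum_antidiagonal_eq_first_add' (s : ℕ) (F : ℕ → ℕ → M) :
    ∑ x ∈ Finset.HasAntidiagonal.antidiagonal s, F x.1 x.2 =
      F 0 s + ∑ b ∈ Finset.range s, F (s - b) b := by
  rw [← Finset.Nat.sum_antidiagonal_swap]
  simp only [Prod.fst_swap, Prod.snd_swap]
  rw [Finset.Nat.sum_antidiagonal_eq_sum_range_succ (fun b i => F i b), Finset.sum_range_succ,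
    add_comm, Nat.sub_self]

/-- The split by second index below, equal to and above `s` separates the modes of the delta
function in `sum_ratioCoeff_mul`. -/
theorem sum_antidiagonal_add (N s : ℕ) (F : ℕ → ℕ → M) :
    ∑ x ∈ Finset.HasAntidiagonal.antidiagonal (N + s), F x.1 x.2 =
      ∑ b ∈ Finset.range s, F (N + s - b) b +
        (F N s + ∑ m ∈ Finset.range N, F (N - (m + 1)) (s + (m + 1))) := by
  rw [← Finset.Nat.sum_antidiagonal_swap]
  simp only [Prod.fst_swap, Prod.snd_swap]
  rw [Finset.Nat.sum_antidiagonal_eq_sum_range_succ (fun b i => F i b),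
    show (N + s).succ = s + (N + 1) by omega, Finset.sum_range_add, Finset.sum_range_succ']
  congr 1
  rw [add_comm, add_zero, Nat.add_sub_cancel]
  congr 1
  refine Finset.sum_congr rfl fun m _ => ?_
  rw [show N + s - (s + (m + 1)) = N - (m + 1) by omega]

end Antidiagonal

section EvalTwo

variable {R : Type*} [CommRing R]

/-- With `y = x^{-1}` and `w = t^{-1}`, the substitution `y ↦ u X`, `w ↦ u^2 X` restricts to the
contact locus `x = u t`. There the combined translation of `p_k` is `(u^k - v^k) u^k - u^{2k} = -1`
times `X^k`: the translation in Bernstein's operator. -/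
theorem evalTwo_map_shift {u v : R} (huv : u * v = 1) (f : MvPolynomial ℕ+ R) :
    evalTwo (MvPolynomial.C u) (MvPolynomial.C (u ^ 2)) ((shift (fun _ => (-1 : R)) f).map
      (shift fun k : ℕ+ => u ^ (k : ℕ) - v ^ (k : ℕ)).toRingHom) = shift (fun _ => (-1 : R)) f := by
  induction f using MvPolynomial.induction_on with
  | C a => rw [map_shift_C, evalTwo_C_C, shift_C]
  | add f g hf hg => simp only [map_add, Polynomial.map_add, hf, hg]
  | mul_X f k hf =>
    rw [map_mul, Polynomial.map_mul, map_mul, hf, map_shift_X, shift_X]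
    simp only [map_add, map_mul, map_pow, evalTwo_C_C, evalTwo_C_X, evalTwo_X, mul_pow, map_sub,
      map_neg, map_one]
    have h1 : (Polynomial.C (MvPolynomial.C u) : Polynomial (MvPolynomial ℕ+ R)) ^ (k : ℕ) *
        Polynomial.C (MvPolynomial.C v) ^ (k : ℕ) = 1 := by
      rw [← mul_pow, ← Polynomial.C_mul, ← MvPolynomial.C_mul, huv]
      simp
    simp only [← pow_mul, mul_comm 2 (k : ℕ)]
    rw [pow_mul]
    linear_combination -(shift (fun _ => (-1 : R)) f) * Polynomial.X ^ (k : ℕ) * h1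

end EvalTwo

/-! ### Commutation of the vertex operator with Bernstein's operators -/

section VertexOperator

variable {R : Type*} [CommRing R] [Algebra ℚ R]

/-- The coefficient of `x^n` in `exp (∑ k ≥ 1, d_k p_k x^k / k)`. -/
def genComplete (d : ℕ+ → R) (n : ℕ) : MvPolynomial ℕ+ R :=
  expCoeff (fun k => (1 / ((k : ℕ) : ℚ)) • (MvPolynomial.C (d k) * MvPolynomial.X k)) n

/-- The coefficient of `x^m` in `(1 - β x) / (1 - α x)`. -/
def ratioCoeff {S : Type*} [CommRing S] (α β : S) (m : ℕ) : S :=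
  if m = 0 then 1 else α ^ (m - 1) * (α - β)

theorem ratioCoeff_zero {S : Type*} [CommRing S] (α β : S) : ratioCoeff α β 0 = 1 := rfl

theorem ratioCoeff_succ {S : Type*} [CommRing S] (α β : S) (m : ℕ) :
    ratioCoeff α β (m + 1) = α ^ m * (α - β) := rfl

/-- Translation multiplies `exp(∑ d_k p_k x^k / k)` by `exp(∑ d_k c_k (x y)^k / k) = (1 - β x y) /
(1 - α x y)`: the contraction of two vertex operators. -/
theorem shift_genComplete (c d : ℕ+ → R) (α β : R)
    (h : ∀ k : ℕ+, d k * c k = α ^ (k : ℕ) - β ^ (k : ℕ)) (N : ℕ) :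
    shift c (genComplete d N) = ∑ x ∈ Finset.HasAntidiagonal.antidiagonal N,
      Polynomial.monomial x.1 (MvPolynomial.C (ratioCoeff α β x.1) * genComplete d x.2) := by
  have e : ∀ k : ℕ+, (shift c).toRingHom ((1 / ((k : ℕ) : ℚ)) •
      (MvPolynomial.C (d k) * MvPolynomial.X k)) =
      (1 / ((k : ℕ) : ℚ)) •
        ((Polynomial.C (MvPolynomial.C α) * Polynomial.X) ^ (k : ℕ) -
          (Polynomial.C (MvPolynomial.C β) * Polynomial.X) ^ (k : ℕ)) +
      Polynomial.C ((1 / ((k : ℕ) : ℚ)) • (MvPolynomial.C (d k) * MvPolynomial.X k)) := by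
    intro k
    rw [map_rat_smul ((shift c).toRingHom), map_rat_smul Polynomial.C, ← smul_add]
    congr 1
    change shift c (MvPolynomial.C (d k) * MvPolynomial.X k) = _
    rw [map_mul, shift_C, shift_X, mul_add, ← mul_assoc, ← Polynomial.C_mul, ← Polynomial.C_mul,
      ← MvPolynomial.C_mul, h, mul_pow, mul_pow, ← sub_mul, MvPolynomial.C_sub, MvPolynomial.C_pow,
      MvPolynomial.C_pow, Polynomial.C_sub, Polynomial.C_pow, Polynomial.C_pow]
    ring
  change (shift c).toRingHom (genComplete d N) = _
  rw [genComplete, map_expCoeff, funext e, expCoeff_add]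
  refine Finset.sum_congr rfl fun x _ => ?_
  rw [expCoeff_pow_sub_pow, ← map_expCoeff Polynomial.C, ← genComplete, ratioCoeff]
  rcases x.1 with _ | m
  · simp
  · rw [if_neg (Nat.succ_ne_zero m), if_neg (Nat.succ_ne_zero m), Nat.add_sub_cancel,
      ← sub_mul, ← Polynomial.C_mul_X_pow_eq_monomial]
    simp only [map_mul, map_pow, map_sub, mul_pow, pow_succ]
    ring

/-- The complete homogeneous symmetric functions over `R`. -/
def completeOver (R : Type*) [CommRing R] [Algebra ℚ R] (n : ℕ) : MvPolynomial ℕ+ R :=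
  genComplete (fun _ => (1 : R)) n

/-- The coefficients of `exp (∑ k ≥ 1, (u^k - v^k) p_k x^k / k)`. -/
def vertexCoeff (u v : R) (s : ℕ) : MvPolynomial ℕ+ R :=
  genComplete (fun k : ℕ+ => u ^ (k : ℕ) - v ^ (k : ℕ)) s

/-- Exponents add: `v^k + (u^k - v^k) = u^k`. -/
theorem sum_pow_mul_completeOver_mul (u v : R) (T : ℕ) :
    ∑ x ∈ Finset.HasAntidiagonal.antidiagonal T, MvPolynomial.C (v ^ x.1) * completeOver R x.1 *
      vertexCoeff u v x.2 =
      MvPolynomial.C (u ^ T) * completeOver R T := by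
  have h : ∀ (r : R) n, MvPolynomial.C (r ^ n) * completeOver R n =
      genComplete (fun k : ℕ+ => r ^ (k : ℕ)) n := by
    intro r n
    rw [completeOver, genComplete, genComplete, MvPolynomial.C_pow, ← expCoeff_rescale]
    congr 1
    ext1 k
    rw [mul_smul_comm, MvPolynomial.C_1, one_mul, MvPolynomial.C_pow]
  simp only [h]
  simp only [vertexCoeff, genComplete]
  rw [← expCoeff_add]
  congr 1
  ext1 k
  rw [← smul_add, ← add_mul, ← MvPolynomial.C_add, add_sub_cancel]

variable (u v : R)

/-- The coefficient of `x^0` in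
`exp (∑ (u^k - v^k) p_k x^k / k) exp (∑ (u^k - v^k) x^{-k} ∂ / ∂ p_k)`. -/
def vertexOp (f : MvPolynomial ℕ+ R) : MvPolynomial ℕ+ R :=
  pairing (vertexCoeff u v) (shift (fun k : ℕ+ => u ^ (k : ℕ) - v ^ (k : ℕ)) f)

/-- Bernstein's operator, the coefficient of `t^n` in
`exp (∑ p_k t^k / k) exp (- ∑ t^{-k} ∂ / ∂ p_k)`. -/
def bernsteinOp (n : ℕ) (f : MvPolynomial ℕ+ R) : MvPolynomial ℕ+ R :=
  pairing (fun j => completeOver R (n + j)) (shift (fun _ => (-1 : R)) f)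

variable {u v}

/-- The coefficientwise form of the delta function identity. The last term is a sum over all modes
`a + b = N + s`, collapsed by `sum_pow_mul_completeOver_mul`; its factor `(u - v) v` equals `1 -
v/u`, the numerator `1 - v t/x` at `x = u t`. -/
theorem sum_ratioCoeff_mul (huv : u * v = 1) (N s : ℕ) :
    ∑ x ∈ Finset.HasAntidiagonal.antidiagonal N, MvPolynomial.C (ratioCoeff u v x.1) *
      completeOver R x.2 * vertexCoeff u v (s + x.1) =
    MvPolynomial.C (v ^ 2) * ∑ x ∈ Finset.HasAntidiagonal.antidiagonal s,
      MvPolynomial.C (ratioCoeff v u x.1) * vertexCoeff u v x.2 * completeOver R (N + x.1) +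
    MvPolynomial.C ((u - v) * v * u ^ (2 * N + s)) * completeOver R (N + s) := by
  have huN : ∀ N, (MvPolynomial.C u : MvPolynomial ℕ+ R) ^ N * MvPolynomial.C v ^ N = 1 := by
    intro N
    rw [← mul_pow, ← MvPolynomial.C_mul, huv, MvPolynomial.C_1, one_pow]
  have huv' := huN 1
  rw [pow_one, pow_one] at huv'
  have hT := sum_pow_mul_completeOver_mul u v (N + s)
  rw [show 2 * N + s = N + (N + s) by ring, pow_add, ← mul_assoc, MvPolynomial.C_mul,
    mul_assoc (MvPolynomial.C ((u - v) * v * u ^ N)), ← hT]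
  clear hT
  rw [sum_antidiagonal_eq_first_add N
      (fun m b => MvPolynomial.C (ratioCoeff u v m) * completeOver R b * vertexCoeff u v (s + m)),
    sum_antidiagonal_eq_first_add' s
      (fun i b => MvPolynomial.C (ratioCoeff v u i) * vertexCoeff u v b * completeOver R (N + i)),
    sum_antidiagonal_add N s
      (fun a b => MvPolynomial.C (v ^ a) * completeOver R a * vertexCoeff u v b),
    mul_add, mul_add, mul_add, Finset.mul_sum, Finset.mul_sum, Finset.mul_sum]
  -- The modes `b > s` come from the expansion in `t/x`.
  have e1 : ∑ m ∈ Finset.range N, MvPolynomial.C (ratioCoeff u v (m + 1)) *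
      completeOver R (N - (m + 1)) * vertexCoeff u v (s + (m + 1)) =
      ∑ m ∈ Finset.range N, MvPolynomial.C ((u - v) * v * u ^ N) *
        (MvPolynomial.C (v ^ (N - (m + 1))) * completeOver R (N - (m + 1)) *
          vertexCoeff u v (s + (m + 1))) := by
    refine Finset.sum_congr rfl fun m hm => ?_
    rw [Finset.mem_range] at hm
    rw [ratioCoeff_succ]
    obtain ⟨t, rfl⟩ : ∃ t, N = m + 1 + t := ⟨N - (m + 1), by omega⟩
    rw [Nat.add_sub_cancel_left]
    simp only [map_mul, map_pow, map_sub, pow_add, pow_one]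
    have := huN t
    linear_combination (-(MvPolynomial.C u ^ m * (MvPolynomial.C u - MvPolynomial.C v) *
      completeOver R t * vertexCoeff u v (s + (m + 1)))) *
        (MvPolynomial.C u * MvPolynomial.C v * this + huv')
  -- The modes `b < s` cancel against the expansion in `x/t`; only `b = s` then remains.
  have e2 : ∑ b ∈ Finset.range s, MvPolynomial.C (v ^ 2) * (MvPolynomial.C (ratioCoeff v u (s - b)) *
      vertexCoeff u v b * completeOver R (N + (s - b))) +
      ∑ b ∈ Finset.range s, MvPolynomial.C ((u - v) * v * u ^ N) *
        (MvPolynomial.C (v ^ (N + s - b)) * completeOver R (N + s - b) * vertexCoeff u v b) = 0 := by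
    rw [← Finset.sum_add_distrib]
    refine Finset.sum_eq_zero fun b hb => ?_
    rw [Finset.mem_range] at hb
    obtain ⟨t, rfl⟩ : ∃ t, s = b + (t + 1) := ⟨s - (b + 1), by omega⟩
    rw [show N + (b + (t + 1)) - b = N + (t + 1) by omega, Nat.add_sub_cancel_left,
      ratioCoeff_succ]
    simp only [map_mul, map_pow, map_sub, pow_add, pow_one]
    have := huN N
    linear_combination ((MvPolynomial.C u - MvPolynomial.C v) * MvPolynomial.C v ^ (t + 2) *
      completeOver R (N + (t + 1)) * vertexCoeff u v b) * this
  rw [e1, ratioCoeff_zero, ratioCoeff_zero, add_zero, add_zero]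
  simp only [map_mul, map_pow, map_sub, map_one, one_mul] at e2 ⊢
  have h3 := huN N
  linear_combination -e2 - (completeOver R N * vertexCoeff u v s) *
    ((MvPolynomial.C u - MvPolynomial.C v) * MvPolynomial.C v * h3 + huv')

theorem pairing_shift_monomial (huv : u * v = 1) (n j s : ℕ) (c : MvPolynomial ℕ+ R) :
    c * pairing (vertexCoeff u v) (Polynomial.monomial s 1 *
        shift (fun k : ℕ+ => u ^ (k : ℕ) - v ^ (k : ℕ)) (completeOver R (n + j))) =
      MvPolynomial.C (v ^ 2) * (c * pairing (fun j => completeOver R (n + j))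
        (Polynomial.monomial j 1 * shift (fun _ => (-1 : R)) (vertexCoeff u v s))) +
      MvPolynomial.C ((u - v) * v * u ^ (2 * n)) *
        (MvPolynomial.C (u ^ 2) ^ j * MvPolynomial.C u ^ s * c * completeOver R (n + (j + s))) := by
  have h1 := shift_genComplete (fun k : ℕ+ => u ^ (k : ℕ) - v ^ (k : ℕ)) (fun _ => (1 : R)) u v
    (fun k => one_mul _) (n + j)
  have h2 := shift_genComplete (fun _ => (-1 : R)) (fun k : ℕ+ => u ^ (k : ℕ) - v ^ (k : ℕ)) v u
    (fun k => by ring) s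
  change shift _ (completeOver R (n + j)) = ∑ x ∈ Finset.HasAntidiagonal.antidiagonal (n + j),
    Polynomial.monomial x.1 (MvPolynomial.C (ratioCoeff u v x.1) * completeOver R x.2) at h1
  change shift _ (vertexCoeff u v s) = ∑ x ∈ Finset.HasAntidiagonal.antidiagonal s,
    Polynomial.monomial x.1 (MvPolynomial.C (ratioCoeff v u x.1) * vertexCoeff u v x.2) at h2
  rw [h1, h2, Finset.mul_sum, Finset.mul_sum]
  simp only [Polynomial.monomial_mul_monomial, map_sum, pairing_monomial, one_mul, ← add_assoc]
  rw [sum_ratioCoeff_mul huv (n + j) s]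
  simp only [map_mul, map_pow, map_sub]
  ring

/-- Both sides are additive in `G`, so `pairing_shift_monomial` suffices. The outer variable of `G`
belongs to Bernstein's operator, the inner one to the vertex operator. -/
theorem pairing_pairing (huv : u * v = 1) (n : ℕ)
    (G : Polynomial (Polynomial (MvPolynomial ℕ+ R))) :
    pairing (vertexCoeff u v) (pairing (fun j =>
        shift (fun k : ℕ+ => u ^ (k : ℕ) - v ^ (k : ℕ)) (completeOver R (n + j))) G) =
      MvPolynomial.C (v ^ 2) * pairing (fun j => completeOver R (n + j))
        (pairing (fun s => shift (fun _ => (-1 : R)) (vertexCoeff u v s))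
          (Polynomial.Bivariate.swap G)) +
      MvPolynomial.C ((u - v) * v * u ^ (2 * n)) *
        pairing (fun j => completeOver R (n + j))
          (evalTwo (MvPolynomial.C u) (MvPolynomial.C (u ^ 2)) G) := by
  induction G using Polynomial.induction_on' with
  | add p q hp hq =>
    simp only [map_add, hp, hq]
    ring
  | monomial j g =>
    induction g using Polynomial.induction_on' with
    | add p q hp hq =>
      simp only [map_add, hp, hq]
      ring
    | monomial s c =>
      have hm : ∀ (t : ℕ) (g : ℕ → MvPolynomial ℕ+ R) (q : Polynomial (MvPolynomial ℕ+ R)),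
          pairing g (Polynomial.monomial t c * q) =
            c * pairing g (Polynomial.monomial t 1 * q) := by
        intro t g q
        rw [← smul_eq_mul c, ← map_smul, ← smul_mul_assoc, Polynomial.smul_monomial, smul_eq_mul,
          mul_one]
      rw [Polynomial.Bivariate.swap_monomial_monomial, evalTwo_monomial, pairing_monomial,
        pairing_monomial, pairing_monomial, hm, hm, pairing_shift_monomial huv]

theorem vertexOp_bernsteinOp (huv : u * v = 1) (n : ℕ) (f : MvPolynomial ℕ+ R) :
    vertexOp u v (bernsteinOp n f) = MvPolynomial.C (v ^ 2) * bernsteinOp n (vertexOp u v f) +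
      MvPolynomial.C ((u - v) * v * u ^ (2 * n)) * bernsteinOp n f := by
  have h1 := map_pairing (shift fun k : ℕ+ => u ^ (k : ℕ) - v ^ (k : ℕ)).toRingHom
    (fun j => completeOver R (n + j)) (shift (fun _ => (-1 : R)) f)
  have h2 := map_pairing (shift fun _ : ℕ+ => (-1 : R)).toRingHom (vertexCoeff u v)
    (shift (fun k : ℕ+ => u ^ (k : ℕ) - v ^ (k : ℕ)) f)
  have h3 := pairing_pairing huv n ((shift (fun _ => (-1 : R)) f).map
    (shift fun k : ℕ+ => u ^ (k : ℕ) - v ^ (k : ℕ)).toRingHom)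
  rw [swap_map_shift, evalTwo_map_shift huv] at h3
  simp only [AlgHom.toRingHom_eq_coe, RingHom.coe_coe] at h1 h2 h3
  have e1 := congrArg (pairing (vertexCoeff u v)) h1
  have e2 := congrArg (pairing fun j => completeOver R (n + j)) h2
  rw [← e1, ← e2] at h3
  exact h3

end VertexOperator

/-! ### Jacobi-Trudi determinants as eigenvectors -/

section JacobiTrudi

variable {R : Type*} [CommRing R] [Algebra ℚ R]

/-- The symmetric function `h_{r - i + j}`, which is `0` if `r - i + j < 0`. -/
def completeEntry (R : Type*) [CommRing R] [Algebra ℚ R] (r i j : ℕ) : MvPolynomial ℕ+ R :=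
  if i ≤ r + j then completeOver R (r + j - i) else 0

theorem completeEntry_succ_succ (r i j : ℕ) :
    completeEntry R r (i + 1) (j + 1) = completeEntry R r i j := by
  rw [completeEntry, completeEntry, ← add_assoc, Nat.add_sub_add_right]
  simp

/-- The translation `p_k ↦ p_k - y^k` multiplies `∑ h_n t^n` by `1 - y t`. The convention `h_n = 0`
for `n < 0` makes this hold at the boundary. -/
theorem shift_completeEntry (r i j : ℕ) :
    shift (fun _ => (-1 : R)) (completeEntry R r i j) =
      Polynomial.C (completeEntry R r i j) -
        Polynomial.X * Polynomial.C (completeEntry R r (i + 1) j) := by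
  have h := shift_genComplete (fun _ => (-1 : R)) (fun _ => (1 : R)) 0 1
    (fun k => by simp [zero_pow k.pos.ne'])
  unfold completeEntry
  by_cases hi : i ≤ r + j
  · rw [if_pos hi, completeOver, h, sum_antidiagonal_eq_first_add _ (fun a b =>
      Polynomial.monomial a (MvPolynomial.C (ratioCoeff (0 : R) 1 a) * genComplete _ b))]
    rcases hN : r + j - i with _ | N
    · rw [if_neg (by omega)]
      simp [ratioCoeff_zero]
    · rw [if_pos (by omega), show r + j - (i + 1) = N by omega, Finset.sum_range_succ',
        Finset.sum_eq_zero]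
      · simp [ratioCoeff_zero, ratioCoeff_succ, ← Polynomial.C_mul_X_pow_eq_monomial, completeOver]
        ring
      · intro m _
        rw [ratioCoeff_succ, pow_succ]
        simp
  · rw [if_neg hi, if_neg (by omega)]
    simp

/-- The Jacobi-Trudi determinant `det (h_{r_i - i + j})`. -/
def jacobiTrudi (R : Type*) [CommRing R] [Algebra ℚ R] {N : ℕ} (r : Fin N → ℕ) :
    MvPolynomial ℕ+ R :=
  (Matrix.of fun i j : Fin N => completeEntry R (r i) i j).det

theorem pairing_det {S : Type*} [CommRing S] {N : ℕ} (g : ℕ → S)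
    (M : Matrix (Fin N) (Fin (N + 1)) S) :
    pairing g (Matrix.of (Fin.cons (fun j : Fin (N + 1) => Polynomial.X ^ (j : ℕ))
      fun i j => Polynomial.C (M i j))).det =
    (Matrix.of (Fin.cons (fun j : Fin (N + 1) => g j) fun i j => M i j)).det := by
  rw [Matrix.det_succ_row_zero, Matrix.det_succ_row_zero, map_sum]
  refine Finset.sum_congr rfl fun j _ => ?_
  have h : (Matrix.of (Fin.cons (fun j : Fin (N + 1) => Polynomial.X ^ (j : ℕ))
      fun i j => Polynomial.C (M i j))).submatrix Fin.succ j.succAbove =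
      Polynomial.C.mapMatrix (M.submatrix id j.succAbove) := by
    ext i k
    simp
  have h' : (Matrix.of (Fin.cons (fun j : Fin (N + 1) => g j) fun i j => M i j)).submatrix Fin.succ j.succAbove =
      M.submatrix id j.succAbove := by
    ext i k
    simp
  rw [h, h', ← RingHom.map_det, Matrix.of_apply, Matrix.of_apply, Fin.cons_zero, Fin.cons_zero,
    show ((-1 : Polynomial S) ^ (j : ℕ) * Polynomial.X ^ (j : ℕ) *
      Polynomial.C (M.submatrix id j.succAbove).det) =
      Polynomial.monomial (j : ℕ) ((-1) ^ (j : ℕ) * (M.submatrix id j.succAbove).det) by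
      rw [← Polynomial.C_mul_X_pow_eq_monomial, Polynomial.C_mul, Polynomial.C_pow,
        Polynomial.C_neg, Polynomial.C_1]
      ring, pairing_monomial]
  ring

/-- Replace the first row `h_{r_0 + j}` by `y^j`; `pairing_det` undoes this by linearity in that
row. Subtracting `y` times the preceding column turns the first row into `(1, 0, …, 0)` and the
minor into the translated smaller determinant. The `r_i` need not decrease. -/
theorem jacobiTrudi_succ {N : ℕ} (r : Fin (N + 1) → ℕ) :
    jacobiTrudi R r = bernsteinOp (r 0) (jacobiTrudi R fun i => r i.succ) := by
  set M : Matrix (Fin N) (Fin (N + 1)) (MvPolynomial ℕ+ R) :=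
    Matrix.of fun i j => completeEntry R (r i.succ) (i + 1) j with hM
  have h1 : jacobiTrudi R r =
      (Matrix.of (Fin.cons (fun j : Fin (N + 1) => completeOver R (r 0 + j)) fun i j => M i j)).det := by
    rw [jacobiTrudi]
    congr 1
    refine Matrix.ext fun i j => ?_
    refine Fin.cases ?_ (fun i => ?_) i
    · simp [completeEntry]
    · simp [hM]
  set D : Matrix (Fin N) (Fin N) (Polynomial (MvPolynomial ℕ+ R)) :=
    (shift fun _ => (-1 : R)).toRingHom.mapMatrix
      (Matrix.of fun i j : Fin N => completeEntry R (r i.succ) i j) with hD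
  set B : Matrix (Fin (N + 1)) (Fin (N + 1)) (Polynomial (MvPolynomial ℕ+ R)) :=
    Matrix.of (Fin.cons (Fin.cons 1 fun _ => 0)
      fun i => Fin.cons (Polynomial.C (M i 0)) (D i)) with hB
  have h2 : (Matrix.of (Fin.cons (fun j : Fin (N + 1) => Polynomial.X ^ (j : ℕ))
      fun i j => Polynomial.C (M i j))).det = B.det := by
    -- These are the column operations; lowering the column index equals raising the row index, by
    -- `completeEntry_succ_succ`.
    apply Matrix.det_eq_of_forall_col_eq_smul_add_pred (fun _ => Polynomial.X)
    · intro i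
      refine Fin.cases ?_ (fun i => ?_) i
      · simp [hB]
      · simp [hB]
    · intro i j
      refine Fin.cases ?_ (fun i => ?_) i
      · simp [hB, pow_succ']
      · have := shift_completeEntry (R := R) (r i.succ) i j
        simp [hB, hD, hM, this, completeEntry_succ_succ]
  have h3 : B.det = shift (fun _ => (-1 : R)) (jacobiTrudi R fun i => r i.succ) := by
    rw [Matrix.det_succ_row_zero, Fin.sum_univ_succ, Finset.sum_eq_zero, add_zero]
    · have : B.submatrix Fin.succ (Fin.succAbove 0) = D := by
        ext i j : 2
        simp [hB]
      rw [this, hD, ← RingHom.map_det]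
      simp [hB, jacobiTrudi]
    · intro j _
      simp [hB]
  rw [h1, ← pairing_det (fun j => completeOver R (r 0 + j)), h2, h3, bernsteinOp]

/-- Peeling off the first row multiplies the old eigenvalue by `v^2`, which moves the other rows
down by one, and adds `(u - v) v u^{2 r_0}`, whose geometric sum is the contribution of the new row.
-/
theorem vertexOp_jacobiTrudi {u v : R} (huv : u * v = 1) {N : ℕ} (r : Fin N → ℕ) :
    vertexOp u v (jacobiTrudi R r) = MvPolynomial.C (1 + (u - v) ^ 2 *
      ∑ i, ∑ j ∈ Finset.range (r i), u ^ (2 * j) * v ^ (2 * (i : ℕ))) * jacobiTrudi R r := by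
  induction N with
  | zero =>
    rw [jacobiTrudi, Matrix.det_isEmpty, vertexOp, map_one, ← Polynomial.monomial_zero_one,
      pairing_monomial, vertexCoeff, genComplete, expCoeff_zero_right]
    simp
  | succ N ih =>
    have h1 : ∑ j ∈ Finset.range (r 0), u ^ (2 * j) * (u - v) = v * (u ^ (2 * r 0) - 1) := by
      rw [← Finset.sum_mul]
      have := mul_geom_sum (u ^ 2) (r 0)
      simp only [← pow_mul] at this
      linear_combination v * this + (-(∑ i ∈ Finset.range (r 0), u ^ (2 * i)) * u) * huv
    rw [jacobiTrudi_succ, vertexOp_bernsteinOp huv, ih]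
    have h2 : ∀ (a : R) (f : MvPolynomial ℕ+ R),
        bernsteinOp (r 0) (MvPolynomial.C a * f) = MvPolynomial.C a * bernsteinOp (r 0) f := by
      intro a f
      rw [bernsteinOp, map_mul, shift_C, Polynomial.C_mul', map_smul, smul_eq_mul, bernsteinOp]
    rw [h2, ← mul_assoc, ← MvPolynomial.C_mul, ← add_mul, ← MvPolynomial.C_add]
    congr 2
    rw [Fin.sum_univ_succ]
    simp only [Fin.val_zero, mul_zero, pow_zero, mul_one, Fin.val_succ]
    have h3 : ∑ i : Fin N, ∑ j ∈ Finset.range (r i.succ), u ^ (2 * j) * v ^ (2 * ((i : ℕ) + 1)) =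
        v ^ 2 * ∑ i : Fin N, ∑ j ∈ Finset.range (r i.succ), u ^ (2 * j) * v ^ (2 * (i : ℕ)) := by
      simp only [Finset.mul_sum]
      refine Finset.sum_congr rfl fun i _ => Finset.sum_congr rfl fun j _ => ?_
      ring
    rw [h3]
    rw [← Finset.sum_mul] at h1
    linear_combination -(u - v) * h1 + huv

end JacobiTrudi

/-! ### The series `z / ζ(z)` and Bernoulli numbers -/

section Zeta

/-- The power series `e^{z/2}`. -/
def expHalf : ℚ⟦X⟧ := PowerSeries.rescale (1 / 2 : ℚ) (PowerSeries.exp ℚ)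

/-- The power series `e^{-z/2}`. -/
def expNegHalf : ℚ⟦X⟧ := PowerSeries.rescale (-1 / 2 : ℚ) (PowerSeries.exp ℚ)

theorem expHalf_mul_expNegHalf : expHalf * expNegHalf = 1 := by
  rw [expHalf, expNegHalf, PowerSeries.exp_mul_exp_eq_exp_add]
  norm_num

theorem rescale_exp_pow (a : ℚ) (k : ℕ) :
    PowerSeries.rescale a (PowerSeries.exp ℚ) ^ k =
      PowerSeries.rescale (a * k) (PowerSeries.exp ℚ) := by
  rw [← map_pow, PowerSeries.exp_pow_eq_rescale_exp, PowerSeries.rescale_rescale, mul_comm]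

theorem rescale_zeta (k : ℕ) :
    PowerSeries.rescale (k : ℚ) zeta = expHalf ^ k - expNegHalf ^ k := by
  rw [expHalf, expNegHalf, rescale_exp_pow, rescale_exp_pow, zeta, map_sub,
    PowerSeries.rescale_rescale, PowerSeries.rescale_rescale]

/-- With `w = e^{z/2}`, `1 / (w - w⁻¹) = 1 / (w - 1) - 1 / (w^2 - 1)`. -/
theorem zDivZeta_eq :
    zDivZeta = 2 * PowerSeries.rescale (1 / 2 : ℚ) (bernoulliPowerSeries ℚ) -
      bernoulliPowerSeries ℚ := by
  have h1 : zDivZeta * (expHalf - expNegHalf) = PowerSeries.X := zDivZeta_mul_zeta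
  have h2 := bernoulliPowerSeries_mul_exp_sub_one ℚ
  have h3 := congrArg (PowerSeries.rescale (1 / 2 : ℚ)) h2
  rw [map_mul, map_sub, map_one, PowerSeries.rescale_X, ← expHalf] at h3
  have h4 : PowerSeries.exp ℚ = expHalf ^ 2 := by
    rw [expHalf, rescale_exp_pow]
    norm_num
  rw [h4] at h2
  have h5 : (2 : ℚ⟦X⟧) * PowerSeries.C (1 / 2 : ℚ) = 1 := by
    rw [show (2 : ℚ⟦X⟧) = PowerSeries.C (2 : ℚ) from (map_ofNat _ 2).symm, ← map_mul]
    norm_num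
  have h6 : expHalf ^ 2 - 1 ≠ 0 := by
    intro h
    rw [h, mul_zero] at h2
    exact PowerSeries.X_ne_zero h2.symm
  refine mul_right_cancel₀ h6 ?_
  linear_combination expHalf * h1 - 2 * (expHalf + 1) * h3 + h2 -
    (expHalf + 1) * PowerSeries.X * h5 + zDivZeta * expHalf_mul_expNegHalf

theorem coeff_zDivZeta (n : ℕ) :
    PowerSeries.coeff n zDivZeta =
      ((2 : ℚ) ^ (1 - (n : ℤ)) - 1) * bernoulli n / (n.factorial : ℚ) := by
  rw [zDivZeta_eq, show (2 : ℚ⟦X⟧) = PowerSeries.C (2 : ℚ) from (map_ofNat _ 2).symm, map_sub,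
    PowerSeries.coeff_C_mul, PowerSeries.coeff_rescale, bernoulliPowerSeries, PowerSeries.coeff_mk,
    zpow_sub₀ two_ne_zero, zpow_one, zpow_natCast, div_pow, one_pow]
  simp only [Algebra.algebraMap_self, RingHom.id_apply]
  ring

theorem coeff_zDivZeta_of_odd {n : ℕ} (h : Odd n) : PowerSeries.coeff n zDivZeta = 0 := by
  rw [coeff_zDivZeta]
  -- Here `B_1 ≠ 0`, but the factor `2^{1-n} - 1` vanishes at `n = 1`.
  rcases eq_or_ne n 1 with rfl | h1
  · norm_num
  · rw [bernoulli_eq_zero_of_odd h (by have := h.pos; omega), mul_zero, zero_div]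

theorem c_zero : c 0 = 1 := by
  rw [c, coeff_zDivZeta]
  norm_num

end Zeta

/-! ### The operator series `J` -/

section OperatorSeries

theorem sum_range_coeff_zDivZeta_smul {M : Type*} [AddCommGroup M] [Module ℚ M] (q : ℕ → M)
    (n : ℕ) :
    ∑ k ∈ Finset.range (n + 2), PowerSeries.coeff k zDivZeta • q (n + 2 - k) =
      q (n + 2) + ∑ x ∈ Finset.Icc 1 (n + 2) ×ˢ Finset.Icc 1 (n + 2) with x.2 + 2 * x.1 = n + 2,
        c x.1 • q x.2 := by
  have h0 : PowerSeries.coeff 0 zDivZeta = 1 := c_zero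
  rw [Finset.sum_range_succ', h0, one_smul, Nat.sub_zero, add_comm]
  congr 1
  symm
  -- The index is `k - 1` with `k = 2α`, the term `k = 0` having been split off; odd `k` contribute
  -- zero.
  refine Finset.sum_bij_ne_zero (fun x _ _ => 2 * x.1 - 1) ?_ ?_ ?_ ?_
  · rintro ⟨α, r⟩ hx -
    simp only [Finset.mem_filter, Finset.mem_product, Finset.mem_Icc, Finset.mem_range] at hx ⊢
    omega
  · rintro ⟨α, r⟩ hx - ⟨α', r'⟩ hx' - h
    simp only [Finset.mem_filter, Finset.mem_product, Finset.mem_Icc] at hx hx'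
    simp only at h
    ext <;> simp only <;> omega
  · intro k hk hne
    rw [Finset.mem_range] at hk
    rcases Nat.even_or_odd (k + 1) with h | h
    · obtain ⟨α, hα⟩ := h
      have e1 : 2 * α = k + 1 := by omega
      refine ⟨(α, n + 2 - (k + 1)), ?_, ?_, ?_⟩
      · simp only [Finset.mem_filter, Finset.mem_product, Finset.mem_Icc]
        omega
      · simpa only [c, e1] using hne
      · simp only
        omega
    · rw [coeff_zDivZeta_of_odd h, zero_smul] at hne
      exact absurd rfl hne
  · rintro ⟨α, r⟩ hx -
    simp only [Finset.mem_filter, Finset.mem_product, Finset.mem_Icc] at hx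
    simp only [c]
    rw [show 2 * α - 1 + 1 = 2 * α by omega, show n + 2 - 2 * α = r by omega]

theorem coeff_J (n : ℕ) :
    PowerSeries.coeff n J = ((n + 1).factorial : ℚ) •
      ∑ k ∈ Finset.range (n + 2), PowerSeries.coeff k zDivZeta • Q (n + 2 - k) := by
  rw [sum_range_coeff_zDivZeta_smul (fun r => Q r) n, J, PowerSeries.coeff_mk, smul_add, Finset.smul_sum]
  congr 1
  refine Finset.sum_congr rfl fun x hx => ?_
  simp only [Finset.mem_filter, Finset.mem_product, Finset.mem_Icc] at hx
  rw [smul_smul, mul_comm, show x.2 - 1 + 2 * x.1 = n + 1 by omega]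

/-- Each application of `ħ² ∂/∂ħ` takes `ħ^r (r-1)!` to `ħ^{r+1} r!`. -/
theorem coeff_iterate_hbarSqDeriv_factorial (q : ℕ → Module.End ℚ PSeries) (k n : ℕ) :
    PowerSeries.coeff n (hbarSqDeriv^[k] (PowerSeries.mk fun r =>
      if r = 0 then 0 else ((r - 1).factorial : ℚ) • q r)) =
      if k < n then ((n - 1).factorial : ℚ) • q (n - k) else 0 := by
  induction k generalizing n with
  | zero =>
    rw [Function.iterate_zero, id, PowerSeries.coeff_mk]
    rcases n with _ | n <;> simp
  | succ k ih =>
    rw [Function.iterate_succ_apply', hbarSqDeriv, PowerSeries.coeff_X_pow_mul']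
    rcases n with _ | _ | n
    · simp
    · simp
    · rw [if_pos (by omega), show n + 1 + 1 - 2 = n by omega, PowerSeries.coeff_mk, ih]
      by_cases h : k < n + 1
      · rw [if_pos h, if_pos (by omega), smul_smul, show n + 1 - k = n + 1 + 1 - (k + 1) by omega,
          Nat.add_sub_cancel, Nat.add_sub_cancel, Nat.factorial_succ, Nat.cast_mul]
      · rw [if_neg h, if_neg (by omega), smul_zero]

theorem X_sq_mul_J :
    PowerSeries.X ^ 2 * J =
      seriesInHbarSqDeriv zDivZeta
          (PowerSeries.mk fun r => if r = 0 then 0 else ((r - 1).factorial : ℚ) • Q r) -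
        PowerSeries.X * PowerSeries.C (Q 1) := by
  ext1 n
  rw [map_sub, seriesInHbarSqDeriv, PowerSeries.coeff_mk]
  simp only [coeff_iterate_hbarSqDeriv_factorial]
  have h0 : PowerSeries.coeff 0 zDivZeta = 1 := c_zero
  rw [Finset.sum_range_succ, if_neg (lt_irrefl n), smul_zero, add_zero,
    PowerSeries.coeff_X_pow_mul']
  rcases n with _ | _ | n
  · simp
  -- In degree one only `k = 0` survives; it gives `Q_1`, which the subtracted `ħ Q_1` cancels.
  · rw [if_neg (by omega), zero_add, Finset.sum_range_one, h0,
      show (1 : ℕ) = 0 + 1 from rfl, PowerSeries.coeff_succ_X_mul]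
    simp
  · rw [if_pos (by omega), show n + 1 + 1 - 2 = n by omega, PowerSeries.coeff_succ_X_mul,
      PowerSeries.coeff_C, if_neg (Nat.succ_ne_zero n), sub_zero, coeff_J, Finset.smul_sum]
    refine Finset.sum_congr rfl fun k hk => ?_
    rw [if_pos (Finset.mem_range.1 hk), smul_comm, Nat.add_sub_cancel]

end OperatorSeries

/-! ### Eigenvalues of `Q_r` on Schur functions -/

section Eigenvalue

theorem map_C_complete (n : ℕ) :
    MvPolynomial.map (PowerSeries.C (R := ℚ)) (complete n) = completeOver ℚ⟦X⟧ n := by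
  simp only [complete, completeOver, genComplete, expCoeff, map_sum, map_mul, map_prod,
    MvPolynomial.map_C, MvPolynomial.map_X, List.prod_ofFn, map_one, one_mul]
  refine Finset.sum_congr rfl fun k _ => ?_
  have h : ∀ (q : ℚ) (f : MvPolynomial ℕ+ ℚ⟦X⟧),
      q • f = MvPolynomial.C (PowerSeries.C q) * f := by
    intro q f
    rw [← MvPolynomial.smul_eq_C_mul]
    exact (algebraMap_smul ℚ⟦X⟧ q f).symm
  simp only [h]

theorem map_C_schur (lam : YoungDiagram) :
    MvPolynomial.map (PowerSeries.C (R := ℚ)) (schur lam) =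
      jacobiTrudi ℚ⟦X⟧ fun i : Fin (lam.colLen 0) => lam.rowLen i := by
  rw [schur, jacobiTrudi, RingHom.map_det]
  congr 1
  refine Matrix.ext fun i j => ?_
  rw [RingHom.mapMatrix_apply, Matrix.map_apply, Matrix.of_apply, Matrix.of_apply, completeEntry]
  split_ifs
  · exact map_C_complete _
  · exact map_zero _

theorem list_prod_derivOp_map (c : ℕ+ → ℚ⟦X⟧) (L : List ℕ+) (f : MvPolynomial ℕ+ ℚ) :
    (L.map (derivOp c)).prod (MvPolynomial.map PowerSeries.C f) =
      MvPolynomial.C (L.map c).prod * MvPolynomial.map PowerSeries.C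
        ((L.map fun k => (MvPolynomial.pderiv k).toLinearMap : List (Module.End ℚ _)).prod f) := by
  induction L with
  | nil => simp
  | cons k L ih =>
    rw [List.map_cons, List.prod_cons, Module.End.mul_apply, ih, derivOp_apply,
      MvPolynomial.pderiv_C_mul, MvPolynomial.pderiv_map, List.map_cons, List.prod_cons,
      List.map_cons, List.prod_cons, MvPolynomial.C_mul, MvPolynomial.smul_eq_C_mul, mul_assoc]
    rfl

theorem list_prod_pderiv_coe (L : List ℕ+) (f : MvPolynomial ℕ+ ℚ) :
    (L.map fun k => ((MvPowerSeries.pderiv ℚ k).toLinearMap : Module.End ℚ PSeries)).prod f =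
      (((L.map fun k => (MvPolynomial.pderiv k).toLinearMap : List (Module.End ℚ _)).prod f :
        MvPolynomial ℕ+ ℚ) : PSeries) := by
  induction L with
  | nil => rfl
  | cons k L ih =>
    rw [List.map_cons, List.prod_cons, Module.End.mul_apply, ih, List.map_cons, List.prod_cons]
    exact MvPowerSeries.pderiv_coe _

/-- Over `ℚ⟦z⟧`, the sum over `l` is a Taylor coefficient of the translation by `ζ(kz) = u^k - v^k`,
and the sum over `k` is `vertexCoeff`. -/
theorem coeff_qTerm (r s : ℕ) (f : MvPolynomial ℕ+ ℚ) (m : ℕ+ →₀ ℕ) :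
    MvPowerSeries.coeff m (qTerm r s f) =
      PowerSeries.coeff (r + 1) (zDivZeta * MvPolynomial.coeff m
        ((shift (fun k : ℕ+ => expHalf ^ (k : ℕ) - expNegHalf ^ (k : ℕ))
          (MvPolynomial.map PowerSeries.C f)).coeff s * vertexCoeff expHalf expNegHalf s)) := by
  have hs : ∀ (q : ℚ) (f : MvPolynomial ℕ+ ℚ⟦X⟧),
      q • f = MvPolynomial.C (PowerSeries.C q) * f := by
    intro q f
    rw [← MvPolynomial.smul_eq_C_mul]
    exact (algebraMap_smul ℚ⟦X⟧ q f).symm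
  set D : Composition s → MvPolynomial ℕ+ ℚ := fun l => (((List.ofFn (part l)).map
    fun k => (MvPolynomial.pderiv k).toLinearMap : List (Module.End ℚ _)).prod f) with hD
  have h1 : (shift (fun k : ℕ+ => expHalf ^ (k : ℕ) - expNegHalf ^ (k : ℕ))
      (MvPolynomial.map PowerSeries.C f)).coeff s =
      ∑ l : Composition s, MvPolynomial.C (PowerSeries.C (1 / (l.length.factorial : ℚ)) *
        ∏ j, PowerSeries.rescale ((part l j : ℕ) : ℚ) zeta) *
        MvPolynomial.map PowerSeries.C (D l) := by
    rw [coeff_shift, expCoeff, LinearMap.sum_apply]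
    refine Finset.sum_congr rfl fun l _ => ?_
    rw [LinearMap.smul_apply, hs, MvPolynomial.C_mul, mul_assoc]
    congr 1
    have := list_prod_derivOp_map (fun k : ℕ+ => expHalf ^ (k : ℕ) - expNegHalf ^ (k : ℕ))
      (List.ofFn (part l)) f
    rw [List.map_ofFn, List.map_ofFn, List.prod_ofFn (f := _ ∘ part l)] at this
    refine this.trans ?_
    simp only [rescale_zeta]
    rfl
  have h2 : vertexCoeff expHalf expNegHalf s =
      ∑ k : Composition s, MvPolynomial.C (PowerSeries.C (1 / (k.length.factorial : ℚ)) *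
        ∏ i, PowerSeries.C (1 / ((part k i : ℕ) : ℚ)) *
          PowerSeries.rescale ((part k i : ℕ) : ℚ) zeta) *
        MvPolynomial.map PowerSeries.C (∏ i, MvPolynomial.X (part k i)) := by
    rw [vertexCoeff, genComplete, expCoeff]
    refine Finset.sum_congr rfl fun k _ => ?_
    simp only [hs, List.prod_ofFn, rescale_zeta, map_mul, map_prod, MvPolynomial.map_X,
      Finset.prod_mul_distrib]
    ring
  have h3 : ∀ k l : Composition s, (mulP k * diffP l) (f : PSeries) =
      (((∏ i, MvPolynomial.X (part k i)) * D l : MvPolynomial ℕ+ ℚ) : PSeries) := by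
    intro k l
    have := list_prod_pderiv_coe (List.ofFn (part l)) f
    rw [List.map_ofFn] at this
    rw [Module.End.mul_apply, diffP]
    refine (congrArg (mulP k) this).trans ?_
    rw [mulP, LinearMap.mulLeft_apply, MvPolynomial.coe_mul]
    congr 1
    rw [← MvPolynomial.coeToMvPowerSeries.ringHom_apply, map_prod]
    simp
  rw [h1, h2, Finset.sum_mul_sum, Finset.sum_comm]
  simp only [MvPolynomial.coeff_sum, Finset.mul_sum, map_sum, qTerm, LinearMap.sum_apply,
    LinearMap.smul_apply, h3]
  refine Finset.sum_congr rfl fun k _ => Finset.sum_congr rfl fun l _ => ?_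
  rw [map_smul, MvPolynomial.coeff_coe, mul_mul_mul_comm, ← MvPolynomial.C_mul, ← map_mul,
    MvPolynomial.coeff_C_mul, MvPolynomial.coeff_map, ← mul_assoc, PowerSeries.coeff_mul_C, qCoeff,
    smul_eq_mul, mul_comm (D l)]
  congr 2
  ring

theorem coeff_Q_coe (r : ℕ) (f : MvPolynomial ℕ+ ℚ) (m : ℕ+ →₀ ℕ) :
    MvPowerSeries.coeff m (Q r f) = PowerSeries.coeff (r + 1) (zDivZeta * MvPolynomial.coeff m
      (vertexOp expHalf expNegHalf (MvPolynomial.map PowerSeries.C f) -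
        MvPolynomial.map PowerSeries.C f)) := by
  set q := shift (fun k : ℕ+ => expHalf ^ (k : ℕ) - expNegHalf ^ (k : ℕ))
    (MvPolynomial.map PowerSeries.C f) with hq
  -- `N` bounds both the cutoff in `Q` and the degree of the Taylor polynomial, so the two finite
  -- sums can be matched.
  set N := max (wt m) q.natDegree with hN
  have h1 : MvPowerSeries.coeff m (Q r f) =
      ∑ s ∈ Finset.range N, MvPowerSeries.coeff m (qTerm r (s + 1) f) := by
    have : MvPowerSeries.coeff m (Q r f) =
      ∑ s ∈ Finset.Icc 1 (wt m), MvPowerSeries.coeff m (qTerm r s f) := rfl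
    rw [this, Finset.range_eq_Ico, Finset.sum_Ico_add' (fun s =>
      MvPowerSeries.coeff m (qTerm r s f))]
    refine Finset.sum_subset (fun s hs => ?_) (fun s _ hs' => ?_)
    · rw [Finset.mem_Icc] at hs
      rw [Finset.mem_Ico]
      have := le_max_left (wt m) q.natDegree
      omega
    · rename_i hs
      rw [Finset.mem_Ico] at hs
      rw [Finset.mem_Icc] at hs'
      exact coeff_qTerm_eq_zero _ _ _ _ (by omega)
  have h2 : vertexOp expHalf expNegHalf (MvPolynomial.map PowerSeries.C f) =
      ∑ s ∈ Finset.range N, q.coeff (s + 1) * vertexCoeff expHalf expNegHalf (s + 1) +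
        MvPolynomial.map PowerSeries.C f := by
    rw [vertexOp, ← hq, pairing_eq_sum _ _ (N := N + 1)
      (by have := le_max_right (wt m) q.natDegree; omega), Finset.sum_range_succ']
    congr 1
    rw [hq, coeff_shift, expCoeff_zero_right, vertexCoeff, genComplete, expCoeff_zero_right,
      mul_one]
    rfl
  rw [h1, h2, add_sub_cancel_right]
  simp only [coeff_qTerm, MvPolynomial.coeff_sum, Finset.mul_sum, map_sum, hq]

theorem sum_rows_eq_sum_cells {M : Type*} [AddCommMonoid M] (lam : YoungDiagram)
    (F : ℕ × ℕ → M) :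
    ∑ i : Fin (lam.colLen 0), ∑ j ∈ Finset.range (lam.rowLen i), F (i, j) =
      ∑ b ∈ lam.cells, F b := by
  rw [Fin.sum_univ_eq_sum_range (fun i => ∑ j ∈ Finset.range (lam.rowLen i), F (i, j)),
    Finset.sum_finset_product lam.cells (Finset.range (lam.colLen 0))
      (fun i => Finset.range (lam.rowLen i))]
  rintro ⟨i, j⟩
  simp only [YoungDiagram.mem_cells, Finset.mem_range, ← YoungDiagram.mem_iff_lt_rowLen,
    ← YoungDiagram.mem_iff_lt_colLen]
  exact ⟨fun h => ⟨lam.up_left_mem le_rfl (Nat.zero_le j) h, h⟩, fun h => h.2⟩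

/-- The generating series `∑_{□ ∈ lam} e^{cr_□ z}` of the contents of `lam`. -/
def contentExp (lam : YoungDiagram) : ℚ⟦X⟧ :=
  ∑ b ∈ lam.cells, PowerSeries.rescale ((content b : ℤ) : ℚ) (PowerSeries.exp ℚ)

theorem vertexOp_schur (lam : YoungDiagram) :
    vertexOp expHalf expNegHalf (MvPolynomial.map PowerSeries.C (schur lam)) =
      MvPolynomial.C (1 + zeta ^ 2 * contentExp lam) *
        MvPolynomial.map PowerSeries.C (schur lam) := by
  rw [map_C_schur, vertexOp_jacobiTrudi expHalf_mul_expNegHalf, contentExp,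
    ← sum_rows_eq_sum_cells]
  congr 4
  refine Finset.sum_congr rfl fun i _ => Finset.sum_congr rfl fun j _ => ?_
  rw [expHalf, expNegHalf, rescale_exp_pow, rescale_exp_pow, PowerSeries.exp_mul_exp_eq_exp_add,
    content]
  congr 2
  push_cast
  ring

/-- Schur functions are eigenvectors of `Q_r`, with eigenvalue the coefficient of `z^r` in
`ζ(z) ∑_{□} e^{cr_□ z}`. -/
theorem Q_schur (r : ℕ) (lam : YoungDiagram) :
    Q r (schur lam : PSeries) =
      PowerSeries.coeff r (zeta * contentExp lam) • (schur lam : PSeries) := by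
  ext m
  rw [coeff_Q_coe, vertexOp_schur, MvPolynomial.C_add, add_mul, MvPolynomial.C_1, one_mul,
    add_sub_cancel_left, MvPolynomial.coeff_C_mul, MvPolynomial.coeff_map, map_smul,
    MvPolynomial.coeff_coe, smul_eq_mul, ← PowerSeries.coeff_mul_C,
    ← PowerSeries.coeff_succ_X_mul r (_ * _), ← zDivZeta_mul_zeta]
  congr 1
  ring

end Eigenvalue

/-! ### Weight preservation -/

section Locality

/-- Two power series in the `p`'s with the same component of weight `d`. -/
def EqInWeight (d : ℕ) (f g : PSeries) : Prop :=
  ∀ m, wt m = d → MvPowerSeries.coeff m f = MvPowerSeries.coeff m g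

theorem wt_add (m n : ℕ+ →₀ ℕ) : wt (m + n) = wt m + wt n := map_add _ _ _

theorem wt_single (k : ℕ+) : wt (Finsupp.single k 1) = k := by
  rw [wt, Finsupp.weight_single, one_smul]

theorem EqInWeight.pderiv {d : ℕ} {k : ℕ+} {f g : PSeries} (h : EqInWeight (d + k) f g) :
    EqInWeight d (MvPowerSeries.pderiv ℚ k f) (MvPowerSeries.pderiv ℚ k g) := by
  intro m hm
  rw [MvPowerSeries.coeff_pderiv, MvPowerSeries.coeff_pderiv,
    h _ (by rw [wt_add, hm, wt_single])]

theorem EqInWeight.list_prod_pderiv (L : List ℕ+) {d : ℕ} {f g : PSeries}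
    (h : EqInWeight (d + (L.map fun k : ℕ+ => (k : ℕ)).sum) f g) :
    EqInWeight d
      ((L.map fun k => ((MvPowerSeries.pderiv ℚ k).toLinearMap : Module.End ℚ PSeries)).prod f)
      ((L.map fun k => ((MvPowerSeries.pderiv ℚ k).toLinearMap : Module.End ℚ PSeries)).prod g) := by
  induction L generalizing d with
  | nil => simpa using h
  | cons k L ih =>
    rw [List.map_cons, List.prod_cons]
    refine EqInWeight.pderiv (ih ?_)
    rwa [List.map_cons, List.sum_cons, ← add_assoc] at h

theorem EqInWeight.X_mul {d : ℕ} {k : ℕ+} {f g : PSeries} (h : EqInWeight d f g) :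
    EqInWeight (d + k) (MvPowerSeries.X k * f) (MvPowerSeries.X k * g) := by
  classical
  intro m hm
  rw [MvPowerSeries.X, MvPowerSeries.coeff_monomial_mul, MvPowerSeries.coeff_monomial_mul]
  split_ifs with hle
  · congr 1
    apply h
    obtain ⟨t, rfl⟩ := exists_add_of_le hle
    rw [add_tsub_cancel_left]
    rw [wt_add, wt_single] at hm
    omega
  · rfl

theorem EqInWeight.list_prod_X_mul (L : List ℕ+) {d : ℕ} {f g : PSeries} (h : EqInWeight d f g) :
    EqInWeight (d + (L.map fun k : ℕ+ => (k : ℕ)).sum)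
      ((L.map fun k => (MvPowerSeries.X k : PSeries)).prod * f)
      ((L.map fun k => (MvPowerSeries.X k : PSeries)).prod * g) := by
  induction L with
  | nil => simpa using h
  | cons k L ih =>
    simp only [List.map_cons, List.prod_cons, List.sum_cons, mul_assoc]
    rw [add_left_comm, add_comm]
    exact ih.X_mul

theorem sum_map_part {s : ℕ} (k : Composition s) :
    ((List.ofFn (part k)).map fun k : ℕ+ => (k : ℕ)).sum = s := by
  rw [List.map_ofFn, List.sum_ofFn]
  exact k.sum_blocksFun

/-- The derivatives lower the weight by `s` and the multiplications restore it. So the operators can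
be computed on a finite part of `Z`, with no continuity argument. -/
theorem EqInWeight.qTerm {d : ℕ} {f g : PSeries} (h : EqInWeight d f g) (r s : ℕ) (hs : s ≤ d) :
    EqInWeight d (qTerm r s f) (qTerm r s g) := by
  intro m hm
  simp only [MonotoneHurwitz.qTerm, LinearMap.sum_apply, LinearMap.smul_apply, map_sum, map_smul]
  refine Finset.sum_congr rfl fun k _ => Finset.sum_congr rfl fun l _ => ?_
  congr 1
  obtain ⟨t, rfl⟩ := exists_add_of_le hs
  have h1 : EqInWeight t (diffP l f) (diffP l g) := by
    have := EqInWeight.list_prod_pderiv (List.ofFn (part l)) (d := t) (f := f) (g := g)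
      (by rwa [sum_map_part, add_comm])
    rwa [List.map_ofFn] at this
  have h2 := h1.list_prod_X_mul (List.ofFn (part k))
  rw [sum_map_part, List.map_ofFn, List.prod_ofFn] at h2
  exact h2 m (by rw [hm, add_comm])

theorem EqInWeight.Q {d : ℕ} {f g : PSeries} (h : EqInWeight d f g) (r : ℕ) :
    EqInWeight d (Q r f) (Q r g) := by
  intro m hm
  change ∑ s ∈ Finset.Icc 1 (wt m), MvPowerSeries.coeff m (MonotoneHurwitz.qTerm r s f) =
    ∑ s ∈ Finset.Icc 1 (wt m), MvPowerSeries.coeff m (MonotoneHurwitz.qTerm r s g)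
  refine Finset.sum_congr rfl fun s hs => ?_
  exact h.qTerm r s (hm ▸ (Finset.mem_Icc.1 hs).2) m hm

theorem EqInWeight.coeff_J {d : ℕ} {f g : PSeries} (h : EqInWeight d f g) (n : ℕ) :
    EqInWeight d (PowerSeries.coeff n J f) (PowerSeries.coeff n J g) := by
  intro m hm
  simp only [MonotoneHurwitz.coeff_J, LinearMap.smul_apply, LinearMap.sum_apply, map_smul, map_sum]
  congr 1
  refine Finset.sum_congr rfl fun k _ => ?_
  rw [h.Q _ m hm]

end Locality

/-! ### The evolution equation -/

section Evolution

/-- The power sum of the contents of `lam`. -/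
def contentPowerSum (lam : YoungDiagram) (n : ℕ) : ℚ := ∑ b ∈ lam.cells, ((content b : ℤ) : ℚ) ^ n

theorem coeff_contentExp (lam : YoungDiagram) (n : ℕ) :
    (n.factorial : ℚ) * PowerSeries.coeff n (contentExp lam) = contentPowerSum lam n := by
  have := Nat.factorial_ne_zero n
  rw [contentExp, map_sum, Finset.mul_sum, contentPowerSum]
  refine Finset.sum_congr rfl fun b _ => ?_
  rw [PowerSeries.coeff_rescale, PowerSeries.coeff_exp]
  simp only [Algebra.algebraMap_self, RingHom.id_apply]
  field_simp

theorem coeff_zero_zeta : PowerSeries.coeff 0 zeta = 0 := by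
  rw [zeta, map_sub, PowerSeries.coeff_rescale, PowerSeries.coeff_rescale, pow_zero, pow_zero,
    sub_self]

/-- The factor `z/ζ` cancels the `ζ` in the eigenvalue of `Q_r`, and `(n+1)!` cancels the factorial
in the coefficient of `e^{cr z}`. -/
theorem coeff_J_schur (n : ℕ) (lam : YoungDiagram) :
    PowerSeries.coeff n J (schur lam : PSeries) =
      contentPowerSum lam (n + 1) • (schur lam : PSeries) := by
  have h : PowerSeries.coeff (n + 2) (zDivZeta * (zeta * contentExp lam)) =
      ∑ k ∈ Finset.range (n + 2), PowerSeries.coeff k zDivZeta *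
        PowerSeries.coeff (n + 2 - k) (zeta * contentExp lam) := by
    rw [PowerSeries.coeff_mul, Finset.Nat.sum_antidiagonal_eq_sum_range_succ
      (fun i j => PowerSeries.coeff i zDivZeta * PowerSeries.coeff j (zeta * contentExp lam)),
      Finset.sum_range_succ, Nat.sub_self]
    -- `J` has no `Q_0` term; the missing summand of the convolution is zero because `ζ(0) = 0`.
    have : PowerSeries.coeff 0 (zeta * contentExp lam) = 0 := by
      rw [PowerSeries.coeff_mul, Finset.Nat.antidiagonal_zero, Finset.sum_singleton,
        coeff_zero_zeta, zero_mul]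
    rw [this, mul_zero, add_zero]
  rw [← mul_assoc, zDivZeta_mul_zeta, PowerSeries.coeff_succ_X_mul] at h
  simp only [coeff_J, LinearMap.smul_apply, LinearMap.sum_apply, Q_schur, smul_smul,
    ← Finset.sum_smul, ← h, coeff_contentExp]

theorem inv_one_sub_eq_geom (a : ℚ) :
    (1 - PowerSeries.C a * PowerSeries.X)⁻¹ = geom a := by
  rw [eq_comm, PowerSeries.eq_inv_iff_mul_eq_one (by simp)]
  exact geom_mul a

theorem derivative_geom (a : ℚ) :
    PowerSeries.derivative ℚ (geom a) = (PowerSeries.mk fun n => a ^ (n + 1)) * geom a := by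
  have h1 : (PowerSeries.mk fun n => a ^ (n + 1)) = PowerSeries.C a * geom a := by
    ext n
    rw [PowerSeries.coeff_mk, PowerSeries.coeff_C_mul, geom, PowerSeries.coeff_mk, pow_succ']
  rw [h1, ← inv_one_sub_eq_geom, PowerSeries.derivative_inv', map_sub, Derivation.leibniz,
    PowerSeries.derivative_C, PowerSeries.derivative_X, PowerSeries.derivative_one]
  simp only [smul_eq_mul]
  ring

/-- The logarithmic derivative of `∏ (1 - ħ cr)⁻¹` is `∑ cr / (1 - ħ cr)`. -/
theorem derivative_contentProd (lam : YoungDiagram) :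
    PowerSeries.derivative ℚ (contentProd lam) =
      (PowerSeries.mk fun n => contentPowerSum lam (n + 1)) * contentProd lam := by
  have h : ∀ s : Finset (ℕ × ℕ), PowerSeries.derivative ℚ
      (∏ b ∈ s, geom ((content b : ℤ) : ℚ)) =
      (PowerSeries.mk fun n => ∑ b ∈ s, ((content b : ℤ) : ℚ) ^ (n + 1)) *
        ∏ b ∈ s, geom ((content b : ℤ) : ℚ) := by
    intro s
    induction s using Finset.induction_on with
    | empty =>
      simp only [Finset.prod_empty, Finset.sum_empty, mul_one, PowerSeries.derivative_one]
      ext n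
      simp
    | insert b s hb ih =>
      have e : (PowerSeries.mk fun n => ∑ b ∈ insert b s, ((content b : ℤ) : ℚ) ^ (n + 1)) =
          (PowerSeries.mk fun n => ((content b : ℤ) : ℚ) ^ (n + 1)) +
          (PowerSeries.mk fun n => ∑ b ∈ s, ((content b : ℤ) : ℚ) ^ (n + 1)) := by
        ext n
        rw [map_add, PowerSeries.coeff_mk, PowerSeries.coeff_mk, PowerSeries.coeff_mk,
          Finset.sum_insert hb]
      rw [Finset.prod_insert hb, Derivation.leibniz, ih, derivative_geom, e, smul_eq_mul,
        smul_eq_mul]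
      ring
  simp only [contentProd, inv_one_sub_eq_geom]
  exact h lam.cells

/-- The component of weight `d` of the coefficient of `ħ^n` in the partition function. -/
def partitionFunctionPart (q : ℕ+) (n d : ℕ) : PSeries :=
  ∑ lam ∈ (finite_card_eq d).toFinset,
    (schurDelta q lam * PowerSeries.coeff n (contentProd lam)) • (schur lam : PSeries)

theorem eqInWeight_partitionFunctionPart (q : ℕ+) (n d : ℕ) :
    EqInWeight d (PowerSeries.coeff n (partitionFunction q)) (partitionFunctionPart q n d) := by
  intro m hm
  have h : PowerSeries.coeff n (partitionFunction q) = (fun m : ℕ+ →₀ ℕ =>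
      ∑ᶠ lam : YoungDiagram, schurDelta q lam * PowerSeries.coeff n (contentProd lam) *
        MvPolynomial.coeff m (schur lam) : PSeries) := PowerSeries.coeff_mk _ _
  have h' : MvPowerSeries.coeff m (PowerSeries.coeff n (partitionFunction q)) =
      ∑ᶠ lam : YoungDiagram, schurDelta q lam * PowerSeries.coeff n (contentProd lam) *
        MvPolynomial.coeff m (schur lam) := congrArg (MvPowerSeries.coeff m) h
  rw [h', partitionFunctionPart, map_sum, finsum_eq_sum_of_support_subset (s := (finite_card_eq d).toFinset)]
  · refine Finset.sum_congr rfl fun lam _ => ?_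
    rw [map_smul, MvPolynomial.coeff_coe, smul_eq_mul]
  · intro lam h
    rw [Set.Finite.coe_toFinset]
    by_contra hne
    refine h ?_
    simp only
    rw [(schur_isWeightedHomogeneous lam).coeff_eq_zero m
      (fun h' => hne (h'.symm.trans hm)), mul_zero]

/-- For a monomial `m`, only diagrams with `wt m` boxes matter. On this finite sum the equation
holds term by term, whatever the coefficients `s_λ(δ_q)`. -/
theorem derivative_partitionFunction (q : ℕ+) :
    PowerSeries.derivative PSeries (partitionFunction q) = act J (partitionFunction q) := by
  ext n m
  have hN : ((n : PSeries) + 1) = MvPowerSeries.C ((n : ℚ) + 1) := by simp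
  rw [PowerSeries.coeff_derivative, hN, MvPowerSeries.coeff_mul_C,
    eqInWeight_partitionFunctionPart q (n + 1) (wt m) m rfl, act, PowerSeries.coeff_mk, map_sum]
  have h : ∀ x ∈ Finset.HasAntidiagonal.antidiagonal n, MvPowerSeries.coeff m
      (PowerSeries.coeff x.1 J (PowerSeries.coeff x.2 (partitionFunction q))) =
      ∑ lam ∈ (finite_card_eq (wt m)).toFinset, schurDelta q lam *
        (contentPowerSum lam (x.1 + 1) * PowerSeries.coeff x.2 (contentProd lam)) *
          MvPolynomial.coeff m (schur lam) := by
    intro x _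
    rw [(eqInWeight_partitionFunctionPart q x.2 (wt m)).coeff_J x.1 m rfl, partitionFunctionPart,
      map_sum, map_sum]
    refine Finset.sum_congr rfl fun lam _ => ?_
    rw [map_smul, coeff_J_schur, map_smul, map_smul, MvPolynomial.coeff_coe, smul_eq_mul,
      smul_eq_mul]
    ring
  rw [Finset.sum_congr rfl h, Finset.sum_comm, partitionFunctionPart, map_sum, Finset.sum_mul]
  refine Finset.sum_congr rfl fun lam _ => ?_
  rw [← Finset.sum_mul, ← Finset.mul_sum, map_smul, MvPolynomial.coeff_coe, smul_eq_mul]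
  have h2 := congrArg (PowerSeries.coeff n) (derivative_contentProd lam)
  rw [PowerSeries.coeff_derivative, PowerSeries.coeff_mul] at h2
  simp only [PowerSeries.coeff_mk] at h2
  rw [← h2]
  ring

end Evolution

end

end MonotoneHurwitz

theorem mainTheorem3 :
    (∀ α : ℕ, PowerSeries.coeff (2 * α + 1) MonotoneHurwitz.zDivZeta = 0 ∧
      MonotoneHurwitz.c α =
        ((2 : ℚ) ^ (1 - 2 * (α : ℤ)) - 1) * bernoulli (2 * α) / ((2 * α).factorial : ℚ)) ∧
    (PowerSeries.X ^ 2 * MonotoneHurwitz.J =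
      MonotoneHurwitz.seriesInHbarSqDeriv MonotoneHurwitz.zDivZeta
          (PowerSeries.mk fun r =>
            if r = 0 then 0 else ((r - 1).factorial : ℚ) • MonotoneHurwitz.Q r) -
        PowerSeries.X * PowerSeries.C (MonotoneHurwitz.Q 1)) ∧
    ∀ q : ℕ+,
      PowerSeries.derivative MonotoneHurwitz.PSeries (MonotoneHurwitz.partitionFunction q) =
        MonotoneHurwitz.act MonotoneHurwitz.J (MonotoneHurwitz.partitionFunction q) := by
  refine ⟨fun α => ⟨MonotoneHurwitz.coeff_zDivZeta_of_odd ⟨α, rfl⟩, ?_⟩,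
    MonotoneHurwitz.X_sq_mul_J, MonotoneHurwitz.derivative_partitionFunction⟩
  rw [MonotoneHurwitz.c, MonotoneHurwitz.coeff_zDivZeta]
  push_cast
  rfl
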